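/- Let $\mathfrak g$ be a finite-dimensional complex simple Lie algebra with Cartan subalgebra $\mathfrak h$ and a choice of positive roots $\Delta_+$. Let $E_\alpha\in\mathfrak g_\alpha$ be root vectors with $\langle E_\alpha,E_{-\alpha}\rangle=1$ for the Killing form, and put $r_0=\sum_{\alpha\in\Delta_+}E_\alpha\wedge E_{-\alpha}$, where $x\wedge y=x\otimes y-y\otimes x$. Let $\Omega\in (S^2\mathfrak g)^{\mathfrak g}$ be the Casimir element of the Killing form. Let $h_1,\dots,h_n$ be a basis of $\mathfrak h$, let $(\lambda_1,\dots,\lambda_n)$ be the coordinates on $\mathfrak h^*$ given by $\lambda_i=\lambda(h_i)$, and let $U\subset\mathfrak h^*$ be open. Let $A=TU\times\mathfrak g$ be the holomorphic gauge Lie algebroid over $U$, with the projection to $TU$ as anchor and the bracket $[X+\xi,Y+\eta]=[X,Y]+[\xi,\eta]+L_X\eta-L_Y\xi$ for vector fields $X,Y$ and $\mathfrak g$-valued holomorphic functions $\xi,\eta$ on $U$. Let $r:U\to\wedge^2\mathfrak g$ be a holomorphic dynamical $r$-matrix with coupling constant $2$, that is, $[h,r(\lambda)]=0$ for all $h\in\mathfrak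 h$ and $\lambda\in U$, and $$\sum_i h_i\wedge\frac{\partial r}{\partial\lambda_i}+\tfrac12[r,r]=[\Omega^{12},\Omega^{23}],$$ where $\tfrac12[r,r]=[r^{12},r^{13}]+[r^{12},r^{23}]+[r^{13},r^{23}]$. Put $\Lambda=\theta+r\in\Gamma(\wedge^2A)$ with $\theta=\sum_i h_i\wedge\frac{\partial}{\partial\lambda_i}$. For $P\in\{\Lambda,r_0\}$, with $r_0$ viewed as a constant section of $\wedge^2A$, equip $A^*$ with the bracket $[\xi,\eta]_P=L_{P^\#\xi}\eta-L_{P^\#\eta}\xi-d(P(\xi,\eta))$, where $\langle\eta,P^\#\xi\rangle=P(\xi,\eta)$, and with the anchor $a_*=a\circ P^\#$, where $a$ is the anchor of $A$. Then $(A,A^*,\Lambda)$ and $(A,A^*,r_0)$ are (coboundary) Lie bialgebroids. Let their doubles be the vector bundle $A\oplus A^*$ with the bilinear form $(X_1+\xi_1,X_2+\xi_2)=\tfrac12(\langle\xi_1,X_2\rangle+\langle\xi_2,X_1\rangle)$, the anchor $a+a_*$, the operator $\mathcal D=d_*+d$, and the Courant bracket $$[X_1+\xi_1,X_2+\xi_2]=\Big([X_1,X_2]+L_{\xi_1}X_2-L_{\xi_2}X_1-\tfrac12d_*(\langle\xi_1,X_2\rangle-\langle\xi_2,X_1\rangle)\Big)+\Big([\xi_1,\xi_2]_P+L_{X_1}\xi_2-L_{X_2}\xi_1+\tfrac12d(\langle\xi_1,X_2\rangle-\langle\xi_2,X_1\rangle)\Big),$$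 where $d_*$ and $L_\xi$ are the differential and Lie derivative of the Lie algebroid $A^*$. These doubles are Courant algebroids, and the double of $(A,A^*,\Lambda)$ is isomorphic, as a Courant algebroid, to the double of $(A,A^*,r_0)$: there is a holomorphic vector bundle isomorphism over the identity of $U$ that preserves the bracket, the bilinear form and the anchor. -/

import Mathlib

open scoped TensorProduct

noncomputable section

namespace DynR

/-! ## Lie algebroids, bialgebroids and Courant algebroids through their sections

For a trivial bundle over `U`, the sections form a free module `Γ` of finite rank over the ring `R`
of holomorphic functions on `U`; sections of the dual bundle are `Module.Dual R Γ`, bundle maps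
covering the identity of `U` are `R`-linear maps, and vector fields act as derivations of `R`. -/

section Algebroid

variable {R Γ : Type*} [CommRing R] [Algebra ℂ R] [AddCommGroup Γ] [Module R Γ]

/-- A skew-symmetric bracket on sections together with an anchor satisfying the Leibniz rule. It is
a Lie algebroid when `IsLieAlgebroid` holds. (Additivity and `ℂ`-linearity in both arguments
follow from the fields.) -/
structure AlmostLieAlgebroid (R Γ : Type*) [CommRing R] [Algebra ℂ R] [AddCommGroup Γ]
    [Module R Γ] where
  bracket : Γ → Γ → Γ
  anchor : Γ →ₗ[R] Derivation ℂ R R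
  bracket_add : ∀ X Y Z, bracket X (Y + Z) = bracket X Y + bracket X Z
  bracket_skew : ∀ X Y, bracket X Y = -bracket Y X
  bracket_smul : ∀ X (f : R) Y, bracket X (f • Y) = f • bracket X Y + anchor X f • Y

namespace AlmostLieAlgebroid

/-- The Lie algebroid axioms: Jacobi identity, and the anchor is a bracket homomorphism. -/
structure IsLieAlgebroid (A : AlmostLieAlgebroid R Γ) : Prop where
  jacobi : ∀ X Y Z, A.bracket (A.bracket X Y) Z + A.bracket (A.bracket Y Z) X
    + A.bracket (A.bracket Z X) Y = 0
  anchor_bracket : ∀ X Y, A.anchor (A.bracket X Y) = ⁅A.anchor X, A.anchor Y⁆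

variable (A : AlmostLieAlgebroid R Γ)

/-- The differential of a function: `⟨d f, X⟩ = a(X) f`. -/
def d (f : R) : Module.Dual R Γ where
  toFun X := A.anchor X f
  map_add' X Y := by simp
  map_smul' g X := by simp

/-- The Lie derivative of a section of the dual bundle:
`⟨L_X ξ, Y⟩ = a(X) ⟨ξ, Y⟩ - ⟨ξ, [X, Y]⟩`. -/
def lieDual (X : Γ) (ξ : Module.Dual R Γ) : Module.Dual R Γ where
  toFun Y := A.anchor X (ξ Y) - ξ (A.bracket X Y)
  map_add' Y Z := by simp only [map_add, A.bracket_add]; ring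
  map_smul' f Y := by
    simp only [map_smul, map_add, A.bracket_smul, smul_eq_mul, Derivation.leibniz,
      RingHom.id_apply]
    ring

end AlmostLieAlgebroid

/-- Sections of the second exterior power, as antisymmetric tensors. -/
def Bivector (R Γ : Type*) [CommRing R] [AddCommGroup Γ] [Module R Γ] :
    Submodule R (Γ ⊗[R] Γ) :=
  LinearMap.ker ((TensorProduct.comm R Γ Γ).toLinearMap + LinearMap.id)

/-- `X ∧ Y = X ⊗ Y - Y ⊗ X`. -/
def wedge (R : Type*) {Γ : Type*} [CommRing R] [AddCommGroup Γ] [Module R Γ] (X Y : Γ) :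
    Bivector R Γ :=
  ⟨X ⊗ₜ[R] Y - Y ⊗ₜ[R] X, by simp [Bivector]⟩

/-- `Λ^# : A^* → A`, the contraction of the first slot: `⟨η, Λ^# ξ⟩ = Λ(ξ, η)`. -/
def sharp {R Γ : Type*} [CommRing R] [AddCommGroup Γ] [Module R Γ] (Λ : Bivector R Γ) : Module.Dual R Γ →ₗ[R] Γ where
  toFun ξ := TensorProduct.lid R Γ (LinearMap.rTensor Γ ξ (Λ : Γ ⊗[R] Γ))
  map_add' ξ η := by simp [LinearMap.rTensor_add]
  map_smul' f ξ := by simp [LinearMap.rTensor_smul]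

theorem sharp_skew {R Γ : Type*} [CommRing R] [AddCommGroup Γ] [Module R Γ]
    (Λ : Bivector R Γ) (ξ η : Module.Dual R Γ) :
    η (sharp Λ ξ) = -ξ (sharp Λ η) := by
  have key : ∀ t : Γ ⊗[R] Γ, η (TensorProduct.lid R Γ (LinearMap.rTensor Γ ξ t))
      = ξ (TensorProduct.lid R Γ (LinearMap.rTensor Γ η (TensorProduct.comm R Γ Γ t))) := by
    intro t
    induction t with
    | zero => simp
    | tmul x y => simp [mul_comm]
    | add x y hx hy => simp only [map_add, hx, hy]
  have h : TensorProduct.comm R Γ Γ (Λ : Γ ⊗[R] Γ) = -(Λ : Γ ⊗[R] Γ) := by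
    have := Λ.2
    simp only [Bivector, LinearMap.mem_ker, LinearMap.add_apply] at this
    exact eq_neg_of_add_eq_zero_left this
  simp only [sharp, LinearMap.coe_mk, AddHom.coe_mk]
  rw [key, h]
  simp

/-- The bracket `[ξ, η]_Λ = L_{Λ^# ξ} η - L_{Λ^# η} ξ - d (Λ(ξ, η))` and the anchor `a ∘ Λ^#` on
the dual bundle. -/
def coboundaryDual (A : AlmostLieAlgebroid R Γ) (Λ : Bivector R Γ) :
    AlmostLieAlgebroid R (Module.Dual R Γ) where
  bracket ξ η := A.lieDual (sharp Λ ξ) η - A.lieDual (sharp Λ η) ξ - A.d (η (sharp Λ ξ))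
  anchor := A.anchor ∘ₗ sharp Λ
  bracket_add ξ η ζ := by
    have hb : ∀ X Y Z, A.bracket (X + Y) Z = A.bracket X Z + A.bracket Y Z := fun X Y Z => by
      rw [A.bracket_skew, A.bracket_add, A.bracket_skew Z X, A.bracket_skew Z Y]; abel
    ext Y
    simp only [AlmostLieAlgebroid.lieDual, AlmostLieAlgebroid.d, LinearMap.sub_apply,
      LinearMap.add_apply, LinearMap.coe_mk, AddHom.coe_mk, map_add, hb, Derivation.add_apply]
    ring
  bracket_skew ξ η := by
    ext Y
    simp only [AlmostLieAlgebroid.lieDual, AlmostLieAlgebroid.d, LinearMap.sub_apply,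
      LinearMap.neg_apply, LinearMap.coe_mk, AddHom.coe_mk]
    rw [sharp_skew Λ ξ η, map_neg]
    ring
  bracket_smul ξ f η := by
    have hb : ∀ X Z, A.bracket (f • X) Z = f • A.bracket X Z - A.anchor Z f • X := fun X Z => by
      rw [A.bracket_skew, A.bracket_smul, A.bracket_skew X Z]
      simp only [smul_neg]; abel
    ext Y
    simp only [AlmostLieAlgebroid.lieDual, AlmostLieAlgebroid.d, LinearMap.sub_apply,
      LinearMap.add_apply, LinearMap.smul_apply, LinearMap.coe_mk, AddHom.coe_mk, map_smul,
      smul_eq_mul, Derivation.leibniz, hb, map_sub, Derivation.smul_apply, LinearMap.comp_apply]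
    rw [sharp_skew Λ ξ η]
    ring

variable [Module.IsReflexive R Γ]

/-- For an algebroid structure on the dual bundle: the differential `d_* f`, a section of `A`. -/
def dStar (A' : AlmostLieAlgebroid R (Module.Dual R Γ)) (f : R) : Γ :=
  (Module.evalEquiv R Γ).symm (A'.d f)

/-- For an algebroid structure on the dual bundle: the Lie derivative `L_ξ X` of a section of `A`,
`⟨η, L_ξ X⟩ = a_*(ξ) ⟨η, X⟩ - ⟨[ξ, η], X⟩`. -/
def lieStar (A' : AlmostLieAlgebroid R (Module.Dual R Γ)) (ξ : Module.Dual R Γ) (X : Γ) : Γ :=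
  (Module.evalEquiv R Γ).symm (A'.lieDual ξ (Module.evalEquiv R Γ X))

/-- The bivector `d_* X`, as a function of two sections of the dual bundle. -/
def dStarSection (A' : AlmostLieAlgebroid R (Module.Dual R Γ)) (X : Γ)
    (ξ η : Module.Dual R Γ) : R :=
  A'.anchor ξ (η X) - A'.anchor η (ξ X) - A'.bracket ξ η X

/-- The Lie derivative `L_X P = [X, P]` of a bivector, as a function of two sections of the dual
bundle. -/
def lieBivector (A : AlmostLieAlgebroid R Γ) (X : Γ)
    (P : Module.Dual R Γ → Module.Dual R Γ → R) (ξ η : Module.Dual R Γ) : R :=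
  A.anchor X (P ξ η) - P (A.lieDual X ξ) η - P ξ (A.lieDual X η)

/-- `(A, A^*)` is a Lie bialgebroid: both are Lie algebroids, and
`d_* [X, Y] = [d_* X, Y] + [X, d_* Y]`, where `[d_* X, Y] = - L_Y (d_* X)`. -/
structure IsLieBialgebroid (A : AlmostLieAlgebroid R Γ)
    (A' : AlmostLieAlgebroid R (Module.Dual R Γ)) : Prop where
  isLie : A.IsLieAlgebroid
  isLie_dual : A'.IsLieAlgebroid
  compat : ∀ X Y ξ η, dStarSection A' (A.bracket X Y) ξ η
    = -lieBivector A Y (dStarSection A' X) ξ η + lieBivector A X (dStarSection A' Y) ξ η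

/-- The operations of a Courant algebroid, on the module `E` of sections. The axioms are
`CourantStructure.IsCourantAlgebroid`. -/
structure CourantStructure (R E : Type*) [CommRing R] [Algebra ℂ R] [AddCommGroup E]
    [Module R E] where
  bracket : E → E → E
  form : E →ₗ[R] E →ₗ[R] R
  anchor : E →ₗ[R] Derivation ℂ R R
  D : R → E

section Courant

variable {E E' : Type*} [AddCommGroup E] [Module R E] [AddCommGroup E'] [Module R E']

/-- `T(e₁, e₂, e₃) = 1/3 ([e₁, e₂], e₃) + cyclic permutations`. -/
def CourantStructure.T (C : CourantStructure R E) (e₁ e₂ e₃ : E) : R :=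
  (1 / 3 : ℂ) • (C.form (C.bracket e₁ e₂) e₃ + C.form (C.bracket e₂ e₃) e₁
    + C.form (C.bracket e₃ e₁) e₂)

/-- The axioms of a Courant algebroid. -/
structure CourantStructure.IsCourantAlgebroid (C : CourantStructure R E) : Prop where
  form_symm : ∀ e₁ e₂, C.form e₁ e₂ = C.form e₂ e₁
  form_nondegenerate : Function.Bijective (C.form : E → Module.Dual R E)
  bracket_add : ∀ e₁ e₂ e₃, C.bracket e₁ (e₂ + e₃) = C.bracket e₁ e₂ + C.bracket e₁ e₃
  bracket_skew : ∀ e₁ e₂, C.bracket e₁ e₂ = -C.bracket e₂ e₁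
  form_D : ∀ f e, C.form (C.D f) e = (1 / 2 : ℂ) • C.anchor e f
  jacobi : ∀ e₁ e₂ e₃, C.bracket (C.bracket e₁ e₂) e₃ + C.bracket (C.bracket e₂ e₃) e₁
    + C.bracket (C.bracket e₃ e₁) e₂ = C.D (C.T e₁ e₂ e₃)
  anchor_bracket : ∀ e₁ e₂, C.anchor (C.bracket e₁ e₂) = ⁅C.anchor e₁, C.anchor e₂⁆
  bracket_smul : ∀ e₁ (f : R) e₂, C.bracket e₁ (f • e₂)
    = f • C.bracket e₁ e₂ + C.anchor e₁ f • e₂ - C.form e₁ e₂ • C.D f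
  anchor_D : ∀ f, C.anchor (C.D f) = 0
  anchor_form : ∀ e h₁ h₂, C.anchor e (C.form h₁ h₂)
    = C.form (C.bracket e h₁ + C.D (C.form e h₁)) h₂
      + C.form h₁ (C.bracket e h₂ + C.D (C.form e h₂))

/-- Isomorphisms of Courant algebroids: bundle isomorphisms over the identity of the base that
preserve the bracket, the bilinear form and the anchor. -/
structure CourantIso (C : CourantStructure R E) (C' : CourantStructure R E') where
  toEquiv : E ≃ₗ[R] E'
  map_bracket : ∀ e₁ e₂, toEquiv (C.bracket e₁ e₂) = C'.bracket (toEquiv e₁) (toEquiv e₂)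
  map_form : ∀ e₁ e₂, C'.form (toEquiv e₁) (toEquiv e₂) = C.form e₁ e₂
  map_anchor : ∀ e, C'.anchor (toEquiv e) = C.anchor e

end Courant

/-- The double `A ⊕ A^*`, with
`(X₁ + ξ₁, X₂ + ξ₂) = 1/2 (⟨ξ₁, X₂⟩ + ⟨ξ₂, X₁⟩)`, `ρ = a + a_*`, `D = d_* + d`, and the bracket
with components
`[X₁, X₂] + L_{ξ₁} X₂ - L_{ξ₂} X₁ - 1/2 d_* (⟨ξ₁, X₂⟩ - ⟨ξ₂, X₁⟩)` and
`[ξ₁, ξ₂] + L_{X₁} ξ₂ - L_{X₂} ξ₁ + 1/2 d (⟨ξ₁, X₂⟩ - ⟨ξ₂, X₁⟩)`. -/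
def double (A : AlmostLieAlgebroid R Γ) (A' : AlmostLieAlgebroid R (Module.Dual R Γ)) :
    CourantStructure R (Γ × Module.Dual R Γ) where
  bracket e₁ e₂ :=
    (A.bracket e₁.1 e₂.1 + lieStar A' e₁.2 e₂.1 - lieStar A' e₂.2 e₁.1
        - dStar A' ((1 / 2 : ℂ) • (e₁.2 e₂.1 - e₂.2 e₁.1)),
      A'.bracket e₁.2 e₂.2 + A.lieDual e₁.1 e₂.2 - A.lieDual e₂.1 e₁.2
        + A.d ((1 / 2 : ℂ) • (e₁.2 e₂.1 - e₂.2 e₁.1)))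
  form := LinearMap.mk₂ R (fun e₁ e₂ => (1 / 2 : ℂ) • (e₁.2 e₂.1 + e₂.2 e₁.1))
    (fun e₁ e₁' e₂ => by
      simp only [Prod.fst_add, Prod.snd_add, map_add, LinearMap.add_apply, ← smul_add]
      congr 1; ring)
    (fun f e₁ e₂ => by
      simp only [Prod.smul_fst, Prod.smul_snd, map_smul, LinearMap.smul_apply, ← smul_add]
      rw [smul_comm])
    (fun e₁ e₂ e₂' => by
      simp only [Prod.fst_add, Prod.snd_add, map_add, LinearMap.add_apply, ← smul_add]
      congr 1; ring)
    (fun f e₁ e₂ => by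
      simp only [Prod.smul_fst, Prod.smul_snd, map_smul, LinearMap.smul_apply, ← smul_add]
      rw [smul_comm])
  anchor := A.anchor.coprod A'.anchor
  D f := (dStar A' f, A.d f)

/-- `(A, A^*, Λ)` is a coboundary Lie bialgebroid. -/
def IsCoboundaryLieBialgebroid (A : AlmostLieAlgebroid R Γ) (Λ : Bivector R Γ) : Prop :=
  IsLieBialgebroid A (coboundaryDual A Λ)

/-- The double of `(A, A^*, Λ)`. -/
def coboundaryDouble (A : AlmostLieAlgebroid R Γ) (Λ : Bivector R Γ) :
    CourantStructure R (Γ × Module.Dual R Γ) :=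
  double A (coboundaryDual A Λ)

end Algebroid

/-! ## Holomorphic functions on an open subset of `ℂⁿ` -/

section Holomorphic

open TopologicalSpace

variable {ι : Type*} [Fintype ι]

/-- Extension by zero of a function on `U`, used only to differentiate it at points of `U`. -/
def extendZero {ι : Type*} {U : Opens (ι → ℂ)} (f : U → ℂ) : (ι → ℂ) → ℂ :=
  Function.extend Subtype.val f 0

theorem extendZero_apply {ι : Type*} {U : Opens (ι → ℂ)} (f : U → ℂ) (x : U) : extendZero f x = f x :=
  Subtype.val_injective.extend_apply f 0 x

theorem eventuallyEq_extendZero {ι : Type*} [Finite ι] {U : Opens (ι → ℂ)} (f : U → ℂ) (g : (ι → ℂ) → ℂ)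
    (h : ∀ y : U, g y = f y) (x : U) : g =ᶠ[nhds (x : ι → ℂ)] extendZero f := by
  filter_upwards [U.isOpen.mem_nhds x.2] with y hy
  exact (h ⟨y, hy⟩).trans (extendZero_apply f ⟨y, hy⟩).symm

/-- The holomorphic functions on `U`, as a subalgebra of all functions on `U`. -/
def holSubalgebra (U : Opens (ι → ℂ)) : Subalgebra ℂ (U → ℂ) where
  carrier := {f | ∀ x : U, AnalyticAt ℂ (extendZero f) x}
  mul_mem' {f g} hf hg x := ((hf x).mul (hg x)).congr
    (eventuallyEq_extendZero (f * g) _ (fun y => by simp [extendZero_apply]) x)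
  add_mem' {f g} hf hg x := ((hf x).add (hg x)).congr
    (eventuallyEq_extendZero (f + g) _ (fun y => by simp [extendZero_apply]) x)
  algebraMap_mem' c x := (analyticAt_const (v := c)).congr
    (eventuallyEq_extendZero _ _ (fun y => by simp) x)

/-- The ring `𝒪(U)` of holomorphic functions on `U`, with pointwise operations. -/
def 𝒪 (U : Opens (ι → ℂ)) : Type _ := holSubalgebra U

instance (U : Opens (ι → ℂ)) : CommRing (𝒪 U) := inferInstanceAs (CommRing (holSubalgebra U))
instance (U : Opens (ι → ℂ)) : Algebra ℂ (𝒪 U) := inferInstanceAs (Algebra ℂ (holSubalgebra U))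

variable {U : Opens (ι → ℂ)}

theorem 𝒪.ext {f g : 𝒪 U} (h : ∀ x, f.1 x = g.1 x) : f = g := Subtype.ext (funext h)

section Partial

variable [DecidableEq ι]

/-- The partial derivative `∂/∂λ_i` of holomorphic functions. -/
def partialDeriv (i : ι) : Derivation ℂ (𝒪 U) (𝒪 U) :=
  Derivation.mk'
    { toFun := fun f => ⟨fun x => fderiv ℂ (extendZero f.1) x (Pi.single i 1), fun x => by
        have h : AnalyticAt ℂ (fun y => fderiv ℂ (extendZero f.1) y (Pi.single i 1)) (x : ι → ℂ) :=
          ((ContinuousLinearMap.apply ℂ ℂ (Pi.single i (1 : ℂ) : ι → ℂ)).analyticAt _).comp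
            (f.2 x).fderiv
        exact h.congr (eventuallyEq_extendZero _ _ (fun y => rfl) x)⟩
      map_add' := fun f g => by
        refine 𝒪.ext fun x => ?_
        have h : extendZero (f.1 + g.1) =ᶠ[nhds (x : ι → ℂ)] extendZero f.1 + extendZero g.1 :=
          (eventuallyEq_extendZero (f.1 + g.1) _ (fun y => by simp [extendZero_apply]) x).symm
        change fderiv ℂ (extendZero (f.1 + g.1)) x _ = _
        rw [h.fderiv_eq, fderiv_add (f.2 x).differentiableAt (g.2 x).differentiableAt]
        rfl
      map_smul' := fun c f => by
        refine 𝒪.ext fun x => ?_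
        have h : extendZero (c • f.1) =ᶠ[nhds (x : ι → ℂ)] c • extendZero f.1 :=
          (eventuallyEq_extendZero (c • f.1) _ (fun y => by simp [extendZero_apply]) x).symm
        change fderiv ℂ (extendZero (c • f.1)) x _ = _
        rw [h.fderiv_eq, fderiv_const_smul (f.2 x).differentiableAt]
        rfl }
    (fun f g => by
      refine 𝒪.ext fun x => ?_
      have h : extendZero (f.1 * g.1) =ᶠ[nhds (x : ι → ℂ)] extendZero f.1 * extendZero g.1 :=
        (eventuallyEq_extendZero (f.1 * g.1) _ (fun y => by simp [extendZero_apply]) x).symm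
      change fderiv ℂ (extendZero (f.1 * g.1)) x _ = f.1 x * fderiv ℂ (extendZero g.1) x _
        + g.1 x * fderiv ℂ (extendZero f.1) x _
      rw [h.fderiv_eq, fderiv_mul (f.2 x).differentiableAt (g.2 x).differentiableAt]
      simp [extendZero_apply])

end Partial

/-- Holomorphic maps from `U` to a finite-dimensional vector space `V`, as a submodule of all maps:
all compositions with linear functionals are holomorphic. -/
def holSubmodule (U : Opens (ι → ℂ)) (V : Type*) [AddCommGroup V] [Module ℂ V] :
    Submodule (holSubalgebra U) (U → V) where
  carrier := {f | ∀ φ : Module.Dual ℂ V, (fun x => φ (f x)) ∈ holSubalgebra U}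
  add_mem' {f g} hf hg φ := by
    have : (fun x => φ ((f + g) x)) = (fun x => φ (f x)) + fun x => φ (g x) := by ext; simp
    rw [this]; exact add_mem (hf φ) (hg φ)
  zero_mem' φ := by
    have : (fun x : U => φ ((0 : U → V) x)) = 0 := by ext; simp
    rw [this]; exact zero_mem _
  smul_mem' c f hf φ := by
    have : (fun x => φ ((c • f) x)) = c.1 * fun x => φ (f x) := by
      ext x
      change φ (c.1 x • f x) = _
      simp
    rw [this]; exact mul_mem c.2 (hf φ)

/-- The `𝒪(U)`-module of holomorphic maps from `U` to `V`, that is, of holomorphic sections of the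
trivial bundle `U × V`. -/
def Hol (U : Opens (ι → ℂ)) (V : Type*) [AddCommGroup V] [Module ℂ V] : Type _ :=
  holSubmodule U V

variable {V : Type*} [AddCommGroup V] [Module ℂ V]

instance : AddCommGroup (Hol U V) := inferInstanceAs (AddCommGroup (holSubmodule U V))
instance : Module (𝒪 U) (Hol U V) :=
  inferInstanceAs (Module (holSubalgebra U) (holSubmodule U V))

namespace Hol

theorem ext {f g : Hol U V} (h : ∀ x, f.1 x = g.1 x) : f = g := Subtype.ext (funext h)

/-- Evaluation at a point. -/
def eval (x : U) : Hol U V →+ V where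
  toFun f := f.1 x
  map_zero' := rfl
  map_add' _ _ := rfl

theorem smul_apply (c : 𝒪 U) (f : Hol U V) (x : U) : (c • f).1 x = c.1 x • f.1 x := rfl

/-- The composition `φ ∘ f` with a linear functional. -/
def comp (φ : Module.Dual ℂ V) : Hol U V →ₗ[𝒪 U] 𝒪 U where
  toFun f := ⟨fun x => φ (f.1 x), f.2 φ⟩
  map_add' f g := 𝒪.ext fun x => φ.map_add (f.1 x) (g.1 x)
  map_smul' c f := 𝒪.ext fun x => φ.map_smul (c.1 x) (f.1 x)

/-- The constant map. -/
def const (U : Opens (ι → ℂ)) (v : V) : Hol U V :=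
  ⟨fun _ => v, fun φ => (holSubalgebra U).algebraMap_mem (φ v)⟩

variable [Module.Finite ℂ V]

theorem sum_comp_coord (f : Hol U V) :
    ∑ j, comp ((Module.finBasis ℂ V).coord j) f • const U (Module.finBasis ℂ V j) = f := by
  refine ext fun x => ?_
  change eval x _ = _
  rw [map_sum]
  exact (Module.finBasis ℂ V).sum_repr (f.1 x)

/-- The coordinates of a holomorphic map in a basis of `V`. -/
def coordEquiv (U : Opens (ι → ℂ)) (V : Type*) [AddCommGroup V] [Module ℂ V]
    [Module.Finite ℂ V] : Hol U V ≃ₗ[𝒪 U] (Fin (Module.finrank ℂ V) → 𝒪 U) :=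
  LinearEquiv.ofLinearMap
    (LinearMap.pi fun j => comp ((Module.finBasis ℂ V).coord j))
    (Fintype.linearCombination (𝒪 U) fun j => const U (Module.finBasis ℂ V j))
    (by
      refine LinearMap.ext fun c => funext fun j => ?_
      have : ∀ k, comp ((Module.finBasis ℂ V).coord j) (const U (Module.finBasis ℂ V k))
          = if k = j then 1 else 0 := fun k => by
        refine 𝒪.ext fun x => ?_
        change (Module.finBasis ℂ V).coord j (Module.finBasis ℂ V k) = _
        split_ifs with h
        · subst h; simp; rfl
        · simp [h]; rfl
      simp [Fintype.linearCombination_apply, this])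
    (by
      refine LinearMap.ext fun f => ?_
      simpa [Fintype.linearCombination_apply] using sum_comp_coord f)

instance : Module.Free (𝒪 U) (Hol U V) := Module.Free.of_equiv (coordEquiv U V).symm

instance : Module.Finite (𝒪 U) (Hol U V) := Module.Finite.equiv (coordEquiv U V).symm

/-- The partial derivative `∂f/∂λ_i` of a vector-valued holomorphic map, computed coordinatewise
in a basis of `V`. -/
def partialDeriv [DecidableEq ι] (i : ι) (f : Hol U V) : Hol U V :=
  ∑ j, DynR.partialDeriv i (comp ((Module.finBasis ℂ V).coord j) f)
    • const U (Module.finBasis ℂ V j)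

end Hol

/-- The pointwise bracket of `𝔤`-valued holomorphic maps. -/
def Hol.lie {𝔤 : Type*} [LieRing 𝔤] [LieAlgebra ℂ 𝔤] [Module.Finite ℂ 𝔤] (f g : Hol U 𝔤) :
    Hol U 𝔤 :=
  ⟨fun x => ⁅f.1 x, g.1 x⁆, fun φ => by
    let b := Module.finBasis ℂ 𝔤
    have : (fun x => φ ⁅f.1 x, g.1 x⁆) = ∑ j, ∑ k,
        φ ⁅b j, b k⁆ • ((fun x => b.coord j (f.1 x)) * fun x => b.coord k (g.1 x)) := by
      ext x
      have hf := b.sum_repr (f.1 x)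
      have hg := b.sum_repr (g.1 x)
      conv_lhs => rw [← hf, ← hg]
      simp only [sum_lie, lie_sum, smul_lie, lie_smul, map_sum, map_smul, smul_eq_mul,
        Finset.sum_apply, Pi.smul_apply, Pi.mul_apply, Module.Basis.coord_apply, Finset.mul_sum]
      rw [Finset.sum_comm]
      refine Finset.sum_congr rfl fun j _ => Finset.sum_congr rfl fun k _ => ?_
      ring
    rw [this]
    exact sum_mem fun j _ => sum_mem fun k _ =>
      (holSubalgebra U).smul_mem (mul_mem (f.2 (b.coord j)) (g.2 (b.coord k))) _⟩

section

variable {𝔤 : Type*} [LieRing 𝔤] [LieAlgebra ℂ 𝔤] [Module.Finite ℂ 𝔤]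

theorem Hol.lie_add (f g k : Hol U 𝔤) : Hol.lie f (g + k) = Hol.lie f g + Hol.lie f k :=
  Hol.ext fun x => _root_.lie_add (f.1 x) (g.1 x) (k.1 x)

theorem Hol.lie_smul (f : Hol U 𝔤) (c : 𝒪 U) (g : Hol U 𝔤) :
    Hol.lie f (c • g) = c • Hol.lie f g :=
  Hol.ext fun x => _root_.lie_smul (c.1 x) (f.1 x) (g.1 x)

theorem Hol.lie_skew (f g : Hol U 𝔤) : Hol.lie f g = -Hol.lie g f :=
  Hol.ext fun x => (_root_.lie_skew (f.1 x) (g.1 x)).symm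

end

end Holomorphic

/-! ## The gauge Lie algebroid `TU × 𝔤` -/

section Gauge

open TopologicalSpace

variable {ι : Type*} [Fintype ι] [DecidableEq ι] (U : Opens (ι → ℂ))
  (𝔤 : Type*) [LieRing 𝔤] [LieAlgebra ℂ 𝔤] [Module.Finite ℂ 𝔤]

/-- Sections of `A = TU × 𝔤`: a vector field `∑ X_i ∂/∂λ_i`, given by its components, and a
`𝔤`-valued function. -/
abbrev GaugeSections : Type _ := (ι → 𝒪 U) × Hol U 𝔤

variable {U 𝔤}

/-- The derivation `∑ X_i ∂/∂λ_i`. -/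
def vectorField : (ι → 𝒪 U) →ₗ[𝒪 U] Derivation ℂ (𝒪 U) (𝒪 U) :=
  Fintype.linearCombination (𝒪 U) fun i => partialDeriv i

/-- The derivative `L_X η` of a vector-valued function along a vector field. -/
def lieFun {V : Type*} [AddCommGroup V] [Module ℂ V] [Module.Finite ℂ V] (X : ι → 𝒪 U)
    (η : Hol U V) : Hol U V :=
  ∑ i, X i • Hol.partialDeriv i η

section

variable {V : Type*} [AddCommGroup V] [Module ℂ V] [Module.Finite ℂ V]

theorem lieFun_add (X : ι → 𝒪 U) (η ζ : Hol U V) :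
    lieFun X (η + ζ) = lieFun X η + lieFun X ζ := by
  simp only [lieFun, Hol.partialDeriv, map_add, add_smul, Finset.sum_add_distrib, smul_add]

theorem add_lieFun (X Y : ι → 𝒪 U) (η : Hol U V) :
    lieFun (X + Y) η = lieFun X η + lieFun Y η := by
  simp only [lieFun, Pi.add_apply, add_smul, Finset.sum_add_distrib]

theorem smul_lieFun (f : 𝒪 U) (X : ι → 𝒪 U) (η : Hol U V) :
    lieFun (f • X) η = f • lieFun X η := by
  simp only [lieFun, Pi.smul_apply, smul_eq_mul, mul_smul, Finset.smul_sum]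

theorem lieFun_smul (X : ι → 𝒪 U) (f : 𝒪 U) (η : Hol U V) :
    lieFun X (f • η) = f • lieFun X η + vectorField X f • η := by
  have h : ∀ i, Hol.partialDeriv i (f • η)
      = f • Hol.partialDeriv i η + partialDeriv i f • η := fun i => by
    have hη : ∑ j, (Hol.comp ((Module.finBasis ℂ V).coord j) η * partialDeriv i f)
        • Hol.const U (Module.finBasis ℂ V j) = partialDeriv i f • η := by
      conv_rhs => rw [← Hol.sum_comp_coord η, Finset.smul_sum]
      exact Finset.sum_congr rfl fun j _ => by rw [mul_comm, mul_smul]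
    rw [← hη]
    simp only [Hol.partialDeriv, map_smul, smul_eq_mul, Derivation.leibniz, add_smul,
      Finset.sum_add_distrib, Finset.smul_sum, mul_smul]
  simp only [lieFun, h, smul_add, Finset.sum_add_distrib, vectorField,
    Fintype.linearCombination_apply, Finset.smul_sum]
  congr 1
  · exact Finset.sum_congr rfl fun i _ => smul_comm _ _ _
  · have hs : (∑ i, X i • partialDeriv i : Derivation ℂ (𝒪 U) (𝒪 U)) f
        = ∑ i, X i * partialDeriv i f := by
      have := map_sum (Derivation.coeFnAddMonoidHom (R := ℂ) (A := 𝒪 U) (M := 𝒪 U))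
        (fun i => X i • partialDeriv i) Finset.univ
      refine (congrFun this f).trans ?_
      rw [Finset.sum_apply]
      rfl
    rw [hs, Finset.sum_smul]
    exact Finset.sum_congr rfl fun i _ => (mul_smul _ _ _).symm

end

variable (U 𝔤) in
/-- The gauge Lie algebroid, with bracket
`[X + ξ, Y + η] = [X, Y] + [ξ, η] + L_X η - L_Y ξ` and anchor the projection to `TU`. -/
def gaugeAlgebroid : AlmostLieAlgebroid (𝒪 U) (GaugeSections U 𝔤) where
  bracket a b :=
    (fun j => vectorField a.1 (b.1 j) - vectorField b.1 (a.1 j),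
      Hol.lie a.2 b.2 + lieFun a.1 b.2 - lieFun b.1 a.2)
  anchor := vectorField ∘ₗ LinearMap.fst _ _ _
  bracket_add a b c := by
    refine Prod.ext (funext fun j => ?_) ?_
    · simp only [Prod.fst_add, Pi.add_apply, map_add, Derivation.add_apply]
      ring
    · simp only [Prod.fst_add, Prod.snd_add, Hol.lie_add, lieFun_add, add_lieFun]
      abel
  bracket_skew a b := by
    refine Prod.ext (funext fun j => ?_) ?_
    · simp
    · simp only [Prod.snd_neg]
      rw [Hol.lie_skew]
      abel
  bracket_smul a f b := by
    refine Prod.ext (funext fun j => ?_) ?_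
    · simp only [Prod.smul_fst, Pi.smul_apply, map_smul, Derivation.smul_apply, smul_eq_mul,
        Derivation.leibniz, Prod.fst_add, Pi.add_apply, LinearMap.comp_apply, LinearMap.fst_apply]
      ring
    · simp only [Prod.smul_fst, Prod.smul_snd, Prod.snd_add, Hol.lie_smul, lieFun_smul,
        smul_lieFun, LinearMap.comp_apply, LinearMap.fst_apply, smul_add, smul_sub]
      abel

/-- The constant section of `A` with value `x ∈ 𝔤`. -/
def constSection (x : 𝔤) : GaugeSections U 𝔤 := (0, Hol.const U x)

/-- The coordinate vector field `∂/∂λ_i` as a section of `A`. -/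
def coordSection (i : ι) : GaugeSections U 𝔤 := (Pi.single i 1, 0)

/-- A holomorphic map `r : U → ⋀² 𝔤` as a section of `⋀² A`: if `r = ∑ r_{jk} b_j ⊗ b_k` in a
basis of `𝔤`, with `r_{jk} = - r_{kj}`, this is `1/2 ∑ r_{jk} b_j ∧ b_k`. -/
def toBivector (r : Hol U (Bivector ℂ 𝔤)) : Bivector (𝒪 U) (GaugeSections U 𝔤) :=
  let b := Module.finBasis ℂ 𝔤
  ∑ j, ∑ k, Hol.comp ((1 / 2 : ℂ) • (b.tensorProduct b).coord (j, k) ∘ₗ (Bivector ℂ 𝔤).subtype) r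
    • wedge (𝒪 U) (constSection (b j)) (constSection (b k))

end Gauge

/-! ## Dynamical `r`-matrices -/

section RMatrix

open TopologicalSpace

variable {𝔤 : Type*} [LieRing 𝔤] [LieAlgebra ℂ 𝔤]

/-- The bracket as a linear map `𝔤 ⊗ 𝔤 → 𝔤`. -/
def brk : 𝔤 ⊗[ℂ] 𝔤 →ₗ[ℂ] 𝔤 := (LieModule.toModuleHom ℂ 𝔤 𝔤 : 𝔤 ⊗[ℂ] 𝔤 →ₗ[ℂ] 𝔤)

/-- `[s¹², t¹³]`: `(x ⊗ y, z ⊗ w) ↦ [x, z] ⊗ y ⊗ w`. -/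
def lie1213 (s t : 𝔤 ⊗[ℂ] 𝔤) : 𝔤 ⊗[ℂ] (𝔤 ⊗[ℂ] 𝔤) :=
  TensorProduct.map brk LinearMap.id (TensorProduct.tensorTensorTensorComm ℂ 𝔤 𝔤 𝔤 𝔤 (s ⊗ₜ t))

/-- `[s¹², t²³]`: `(x ⊗ y, z ⊗ w) ↦ x ⊗ [y, z] ⊗ w`. -/
def lie1223 (s t : 𝔤 ⊗[ℂ] 𝔤) : 𝔤 ⊗[ℂ] (𝔤 ⊗[ℂ] 𝔤) :=
  LinearMap.lTensor 𝔤 (LinearMap.rTensor 𝔤 brk ∘ₗ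
      (TensorProduct.assoc ℂ 𝔤 𝔤 𝔤).symm.toLinearMap)
    (TensorProduct.assoc ℂ 𝔤 𝔤 (𝔤 ⊗[ℂ] 𝔤) (s ⊗ₜ t))

/-- `[s¹³, t²³]`: `(x ⊗ y, z ⊗ w) ↦ x ⊗ z ⊗ [y, w]`. -/
def lie1323 (s t : 𝔤 ⊗[ℂ] 𝔤) : 𝔤 ⊗[ℂ] (𝔤 ⊗[ℂ] 𝔤) :=
  TensorProduct.assoc ℂ 𝔤 𝔤 𝔤 (TensorProduct.map LinearMap.id brk
    (TensorProduct.tensorTensorTensorComm ℂ 𝔤 𝔤 𝔤 𝔤 (s ⊗ₜ t)))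

/-- For `r ∈ ⋀² 𝔤`, the element `1/2 [r, r] = [r¹², r¹³] + [r¹², r²³] + [r¹³, r²³]` of
`⋀³ 𝔤 ⊆ 𝔤 ⊗ 𝔤 ⊗ 𝔤`, with `[r, r]` the Schouten bracket. -/
def halfSchouten (r : 𝔤 ⊗[ℂ] 𝔤) : 𝔤 ⊗[ℂ] (𝔤 ⊗[ℂ] 𝔤) :=
  lie1213 r r + lie1223 r r + lie1323 r r

variable [Module.Finite ℂ 𝔤]

/-- The Casimir element `Ω = ∑ x_j ⊗ x^j ∈ (S² 𝔤)^𝔤` of the Killing form, with `x_j` a basis and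
`x^j` the dual basis with respect to the Killing form. -/
def casimir (𝔤 : Type*) [LieRing 𝔤] [LieAlgebra ℂ 𝔤] [Module.Finite ℂ 𝔤]
    [LieAlgebra.IsKilling ℂ 𝔤] : 𝔤 ⊗[ℂ] 𝔤 :=
  ∑ j, Module.finBasis ℂ 𝔤 j ⊗ₜ[ℂ] LinearMap.BilinForm.dualBasis (killingForm ℂ 𝔤)
    (LieAlgebra.IsKilling.killingForm_nondegenerate ℂ 𝔤) (Module.finBasis ℂ 𝔤) j

variable (H : LieSubalgebra ℂ 𝔤) {ι : Type*} [Fintype ι] [DecidableEq ι]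
  (h : Module.Basis ι ℂ H) {U : Opens (ι → ℂ)}

/-- `Alt(dr) = ∑ h_i ∧ ∂r/∂λ_i = ∑ (h_i¹ ∂_i r²³ - h_i² ∂_i r¹³ + h_i³ ∂_i r¹²)`. -/
def altD (r : Hol U (Bivector ℂ 𝔤)) (x : U) : 𝔤 ⊗[ℂ] (𝔤 ⊗[ℂ] 𝔤) :=
  ∑ i, ((h i : 𝔤) ⊗ₜ[ℂ] ((Hol.partialDeriv i r).1 x : 𝔤 ⊗[ℂ] 𝔤)
    - LinearMap.lTensor 𝔤 (TensorProduct.mk ℂ 𝔤 𝔤 (h i : 𝔤))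
        ((Hol.partialDeriv i r).1 x : 𝔤 ⊗[ℂ] 𝔤)
    + LinearMap.lTensor 𝔤 ((TensorProduct.mk ℂ 𝔤 𝔤).flip (h i : 𝔤))
        ((Hol.partialDeriv i r).1 x : 𝔤 ⊗[ℂ] 𝔤))

/-- Dynamical `r`-matrices with coupling constant `ε = 2`: `𝔥`-invariant solutions of the modified
classical dynamical Yang-Baxter equation `Alt(dr) + 1/2 [r, r] = ε²/4 [Ω¹², Ω²³]`. -/
structure IsDynamicalRMatrix [LieAlgebra.IsKilling ℂ 𝔤] (r : Hol U (Bivector ℂ 𝔤)) : Prop where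
  zero_weight : ∀ x : U, ∀ y ∈ H, ⁅y, (r.1 x : 𝔤 ⊗[ℂ] 𝔤)⁆ = 0
  cdybe : ∀ x : U, altD H h r x + halfSchouten (r.1 x : 𝔤 ⊗[ℂ] 𝔤)
    = ((2 : ℂ) ^ 2 / 4) • lie1223 (casimir 𝔤) (casimir 𝔤)

/-- `θ = ∑ h_i ∧ ∂/∂λ_i`, a constant section of `⋀² A`. -/
def θ (U : Opens (ι → ℂ)) : Bivector (𝒪 U) (GaugeSections U 𝔤) :=
  ∑ i, wedge (𝒪 U) (constSection (h i : 𝔤)) (coordSection i)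

/-- The twisted `r`-matrix `Λ = θ + r`, a section of `⋀² A`. -/
def twistedR (r : Hol U (Bivector ℂ 𝔤)) : Bivector (𝒪 U) (GaugeSections U 𝔤) :=
  θ H h U + toBivector r

open Classical in
/-- The standard `r`-matrix `r₀ = ∑_{α > 0} E_α ∧ E_{-α}`. -/
def standardR [LieAlgebra.IsKilling ℂ 𝔤] [H.IsCartanSubalgebra]
    (b : (LieAlgebra.IsKilling.rootSystem H).Base) (E : LieModule.Weight ℂ H 𝔤 → 𝔤) :
    Bivector ℂ 𝔤 :=
  ∑ α : H.root with b.IsPos α, wedge ℂ (E α.1) (E (-α.1))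

/-- The standard `r`-matrix as a constant section of `⋀² A`. -/
def untwistedR (U : Opens (ι → ℂ)) [LieAlgebra.IsKilling ℂ 𝔤] [H.IsCartanSubalgebra]
    (b : (LieAlgebra.IsKilling.rootSystem H).Base) (E : LieModule.Weight ℂ H 𝔤 → 𝔤) :
    Bivector (𝒪 U) (GaugeSections U 𝔤) :=
  toBivector (Hol.const U (standardR H b E))

end RMatrix

end DynR

end

noncomputable section

namespace DynR

open TopologicalSpace AlmostLieAlgebroid

/-! ### Bracket identities for almost Lie algebroids -/

section Abstract

variable {R Γ : Type*} [CommRing R] [Algebra ℂ R] [AddCommGroup Γ] [Module R Γ]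

/-! Both doubles are sheared onto one and the same Courant algebroid. For a bivector `Λ`, the shear
X + ξ ↦ (X + Λ^# ξ) + ξ turns the double of (A, A^*, Λ) into A ⊕ A^* with its standard bracket plus
one extra term Φ(ξ, η) in A, where Φ(ξ, η) = Λ^#[ξ, η]_Λ - [Λ^# ξ, Λ^# η] (`coboundaryDoubleIso`).
Up to sign and normalisation Φ is the Schouten square of `Λ`.

For `Λ = θ + r` the dynamical Yang-Baxter equation says that Φ(ξ, η) = [Kξ, Kη], where K sends a
covector to the 𝔤-valued function representing its 𝔤-part under the Killing form. This is the
trivector [Ω¹², Ω²³] up to sign. For `r₀` the modified Yang-Baxter equation gives the same Φ.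
`sharp_gaugeBivector_bracket` treats both cases at once, with bivectors ∑ k_i ∧ ∂/∂λ_i + r: k_i =
h_i for the first, k = 0 for the second. Composing one shear with the inverse of the other gives the
isomorphism X + ξ ↦ X + (Λ^# - r₀^#)ξ + ξ.

The remaining claims come from the same picture. Φ is skew, cyclic, killed by the anchor and
invariant (`casimirTrivector_isInvariantTrivector`), which makes the twisted structure a Courant
algebroid (`twistedCourant_isCourantAlgebroid`); its axioms are pulled back along the shear. Since
A^* is isotropic and closed under the bracket of the double, the Jacobi identity there has no defect
on A^*. Compatibility holds because d_* X = -L_X Λ and L_{[X, Y]} = [L_X, L_Y].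

The Yang-Baxter equation for `r₀` is checked on root spaces: under the Killing form `r₀` is the
operator equal to -1 on positive root spaces, 1 on negative ones and 0 on the Cartan subalgebra
(`standardEnd_modified_yangBaxter`). -/

theorem half_add_half (x : R) : (1 / 2 : ℂ) • x + (1 / 2 : ℂ) • x = x := by
  rw [← add_smul]; norm_num

theorem half_two_mul (x : R) : (1 / 2 : ℂ) • (2 * x) = x := by
  rw [two_mul, smul_add, half_add_half]

namespace AlmostLieAlgebroid

variable (A : AlmostLieAlgebroid R Γ)

theorem add_bracket (X Y Z : Γ) : A.bracket (X + Y) Z = A.bracket X Z + A.bracket Y Z := by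
  rw [A.bracket_skew, A.bracket_add, A.bracket_skew Z X, A.bracket_skew Z Y]; abel

@[simp] theorem bracket_zero (X : Γ) : A.bracket X 0 = 0 := by
  simpa using A.bracket_add X 0 0

@[simp] theorem zero_bracket (X : Γ) : A.bracket 0 X = 0 := by
  rw [A.bracket_skew, bracket_zero, neg_zero]

@[simp] theorem bracket_neg (X Y : Γ) : A.bracket X (-Y) = -A.bracket X Y := by
  rw [eq_neg_iff_add_eq_zero, ← A.bracket_add, neg_add_cancel, bracket_zero]

theorem smul_bracket (X : Γ) (f : R) (Y : Γ) :
    A.bracket (f • X) Y = f • A.bracket X Y - A.anchor Y f • X := by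
  rw [A.bracket_skew, A.bracket_smul, A.bracket_skew X Y, smul_neg]; abel

@[simp] theorem d_apply (f : R) (X : Γ) : A.d f X = A.anchor X f := rfl

@[simp] theorem lieDual_apply (X Y : Γ) (ξ : Module.Dual R Γ) :
    A.lieDual X ξ Y = A.anchor X (ξ Y) - ξ (A.bracket X Y) := rfl

/-- The Jacobi identity as the Leibniz rule for the adjoint action. -/
theorem IsLieAlgebroid.leibniz {A : AlmostLieAlgebroid R Γ} (hA : A.IsLieAlgebroid) (X Y Z : Γ) :
    A.bracket (A.bracket X Y) Z = A.bracket X (A.bracket Y Z) - A.bracket Y (A.bracket X Z) := by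
  have h := hA.jacobi X Y Z
  rw [A.bracket_skew (A.bracket Y Z) X, A.bracket_skew (A.bracket Z X) Y, A.bracket_skew Z X,
    bracket_neg] at h
  rw [← sub_eq_zero, ← h]; abel

end AlmostLieAlgebroid

/-- A trivector `ζ (Φ ξ η)` that is invariant under all Lie derivatives and lies in the kernel of
the anchor. -/
structure IsInvariantTrivector (A : AlmostLieAlgebroid R Γ)
    (Φ : Module.Dual R Γ →ₗ[R] Module.Dual R Γ →ₗ[R] Γ) : Prop where
  skew : ∀ ξ η, Φ ξ η = -Φ η ξ
  cyclic : ∀ (ξ η ζ : Module.Dual R Γ), ζ (Φ ξ η) = ξ (Φ η ζ)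
  anchor : ∀ ξ η, A.anchor (Φ ξ η) = 0
  invariant : ∀ X ξ η, A.bracket X (Φ ξ η) = Φ (A.lieDual X ξ) η + Φ ξ (A.lieDual X η)

/-! ### The standard Courant bracket twisted by an invariant trivector -/

section Twisted

variable (A : AlmostLieAlgebroid R Γ) (Φ : Module.Dual R Γ →ₗ[R] Module.Dual R Γ →ₗ[R] Γ)

/-- The symmetric pairing on `A ⊕ A^*`. -/
def pairing (R Γ : Type*) [CommRing R] [Algebra ℂ R] [AddCommGroup Γ] [Module R Γ] :
    (Γ × Module.Dual R Γ) →ₗ[R] (Γ × Module.Dual R Γ) →ₗ[R] R :=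
  LinearMap.mk₂ R (fun e₁ e₂ => (1 / 2 : ℂ) • (e₁.2 e₂.1 + e₂.2 e₁.1))
    (fun e₁ e₁' e₂ => by
      simp only [Prod.fst_add, Prod.snd_add, map_add, LinearMap.add_apply, ← smul_add]
      congr 1; ring)
    (fun f e₁ e₂ => by
      simp only [Prod.smul_fst, Prod.smul_snd, map_smul, LinearMap.smul_apply, ← smul_add]
      rw [smul_comm])
    (fun e₁ e₂ e₂' => by
      simp only [Prod.fst_add, Prod.snd_add, map_add, LinearMap.add_apply, ← smul_add]
      congr 1; ring)
    (fun f e₁ e₂ => by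
      simp only [Prod.smul_fst, Prod.smul_snd, map_smul, LinearMap.smul_apply, ← smul_add]
      rw [smul_comm])

theorem pairing_apply (e₁ e₂ : Γ × Module.Dual R Γ) :
    pairing R Γ e₁ e₂ = (1 / 2 : ℂ) • (e₁.2 e₂.1 + e₂.2 e₁.1) := rfl

/-- The standard Courant structure on `A ⊕ A^*`, twisted by a trivector. -/
def twistedCourant : CourantStructure R (Γ × Module.Dual R Γ) where
  bracket e₁ e₂ := (A.bracket e₁.1 e₂.1 + Φ e₁.2 e₂.2,
    A.lieDual e₁.1 e₂.2 - A.lieDual e₂.1 e₁.2 + A.d ((1 / 2 : ℂ) • (e₁.2 e₂.1 - e₂.2 e₁.1)))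
  form := pairing R Γ
  anchor := A.anchor ∘ₗ LinearMap.fst R _ _
  D f := (0, A.d f)

theorem pairing_bijective [Module.IsReflexive R Γ] : Function.Bijective (pairing R Γ) := by
  constructor
  · refine (injective_iff_map_eq_zero (pairing R Γ)).2 ?_
    rintro ⟨X, ξ⟩ h
    have h' : ∀ e, pairing R Γ (X, ξ) e = 0 := fun e => by
      simpa using congrArg (fun F : Module.Dual R _ => F e) h
    simp only [pairing_apply] at h'
    have h2 : ∀ x : R, (1 / 2 : ℂ) • x = 0 → x = 0 := fun x hx => by
      rw [← half_add_half x, hx, add_zero]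
    refine Prod.ext ?_ ?_
    · refine (Module.evalEquiv R Γ).injective (LinearMap.ext fun η => ?_)
      simpa using h2 _ (h' (0, η))
    · exact LinearMap.ext fun Y => by simpa using h2 _ (h' (Y, 0))
  · intro F
    -- The factor 2 cancels the 1/2 in the pairing; reflexivity turns the restriction of F to A^*
    -- into a section of A.
    refine ⟨((Module.evalEquiv R Γ).symm (2 • F ∘ₗ LinearMap.inr R _ _),
      2 • F ∘ₗ LinearMap.inl R _ _), LinearMap.ext fun e => ?_⟩
    have h : e.2 ((Module.evalEquiv R Γ).symm (2 • F ∘ₗ LinearMap.inr R _ _)) = 2 * F (0, e.2) := by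
      simp
    rw [pairing_apply, h]
    simp only [LinearMap.smul_apply, LinearMap.comp_apply, LinearMap.inl_apply, nsmul_eq_mul,
      Nat.cast_ofNat, ← mul_add, half_two_mul, ← map_add]
    simp

variable {A Φ}

theorem twistedCourant_bracket_skew (hΦ : IsInvariantTrivector A Φ) (e₁ e₂) :
    (twistedCourant A Φ).bracket e₁ e₂ = -(twistedCourant A Φ).bracket e₂ e₁ := by
  refine Prod.ext ?_ (LinearMap.ext fun Y => ?_)
  · simp only [twistedCourant, Prod.fst_neg]
    rw [A.bracket_skew, hΦ.skew]; abel
  · simp only [twistedCourant, Prod.snd_neg, LinearMap.add_apply, LinearMap.sub_apply,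
      LinearMap.neg_apply, d_apply, lieDual_apply, map_sub, Derivation.map_smul, smul_sub]
    abel

/-- By cyclicity, pairing with η gives ⟨df, Φ(ξ, η)⟩ = a(Φ(ξ, η)) f, which vanishes because Φ takes
values in the kernel of the anchor. -/
theorem IsInvariantTrivector.apply_d (hΦ : IsInvariantTrivector A Φ) [Module.IsReflexive R Γ]
    (f : R) (ξ : Module.Dual R Γ) : Φ (A.d f) ξ = 0 := by
  refine (Module.evalEquiv R Γ).injective (LinearMap.ext fun η => ?_)
  simp [hΦ.cyclic, hΦ.anchor]

/-- The exact terms are killed by Φ. Invariance expands each [Φ(ξ, η), Z] into terms that cancel the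
Φ(L_X η, ζ) terms, leaving the Jacobi identity of A. There is no defect because D f has no component
in A. -/
theorem twistedCourant_jacobi_fst (hA : A.IsLieAlgebroid) (hΦ : IsInvariantTrivector A Φ)
    [Module.IsReflexive R Γ] (X Y Z : Γ) (ξ η ζ : Module.Dual R Γ) :
    A.bracket (A.bracket X Y + Φ ξ η) Z
      + Φ (A.lieDual X η - A.lieDual Y ξ + A.d ((1 / 2 : ℂ) • (ξ Y - η X))) ζ
      + (A.bracket (A.bracket Y Z + Φ η ζ) X
      + Φ (A.lieDual Y ζ - A.lieDual Z η + A.d ((1 / 2 : ℂ) • (η Z - ζ Y))) ξ)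
      + (A.bracket (A.bracket Z X + Φ ζ ξ) Y
      + Φ (A.lieDual Z ξ - A.lieDual X ζ + A.d ((1 / 2 : ℂ) • (ζ X - ξ Z))) η) = 0 := by
  simp only [add_bracket, map_add, map_sub, LinearMap.add_apply, LinearMap.sub_apply, hΦ.apply_d,
    A.bracket_skew (Φ _ _) _, hΦ.invariant]
  rw [hΦ.skew (A.lieDual Y ξ) ζ, hΦ.skew (A.lieDual X ζ) η, hΦ.skew (A.lieDual Z η) ξ]
  simp only [add_zero]
  rw [← hA.jacobi X Y Z]
  abel

/-- For Φ = 0 this is the usual defect of the Courant bracket on A ⊕ A^*. The Φ-terms are a(W)⟨ζ,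
Φ(ξ, η)⟩ and its expansion by invariance, and cyclicity makes the three cyclic copies agree. -/
theorem twistedCourant_jacobi_snd (hA : A.IsLieAlgebroid) (hΦ : IsInvariantTrivector A Φ)
    (e₁ e₂ e₃ : Γ × Module.Dual R Γ) (W : Γ) :
    ((twistedCourant A Φ).bracket ((twistedCourant A Φ).bracket e₁ e₂) e₃).2 W
    + ((twistedCourant A Φ).bracket ((twistedCourant A Φ).bracket e₂ e₃) e₁).2 W
    + ((twistedCourant A Φ).bracket ((twistedCourant A Φ).bracket e₃ e₁) e₂).2 W
    = A.anchor W ((twistedCourant A Φ).T e₁ e₂ e₃) := by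
  obtain ⟨X, ξ⟩ := e₁
  obtain ⟨Y, η⟩ := e₂
  obtain ⟨Z, ζ⟩ := e₃
  have hc : 2 * algebraMap ℂ R (1 / 2) = 1 := by
    rw [← map_ofNat (algebraMap ℂ R) 2, ← map_mul]; norm_num
  have ht : 3 * algebraMap ℂ R (1 / 3) = 1 := by
    rw [← map_ofNat (algebraMap ℂ R) 3, ← map_mul]; norm_num
  have cyc1 := congrArg (A.anchor W) (hΦ.cyclic ξ η ζ)
  have cyc2 := congrArg (A.anchor W) (hΦ.cyclic η ζ ξ)
  have i1 : ∀ ξ η ζ : Module.Dual R Γ, ζ (A.bracket (Φ ξ η) W) = -(ζ (Φ (A.lieDual W ξ) η)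
      + ζ (Φ ξ (A.lieDual W η))) := fun ξ η ζ => by
    rw [A.bracket_skew, hΦ.invariant, map_neg, map_add]
  have i2 : ∀ ξ η ζ : Module.Dual R Γ, A.anchor W (ζ (Φ ξ η)) = A.lieDual W ζ (Φ ξ η)
      + ζ (Φ (A.lieDual W ξ) η) + ζ (Φ ξ (A.lieDual W η)) := fun ξ η ζ => by
    rw [lieDual_apply, hΦ.invariant, map_add]; ring
  have e1 := hΦ.cyclic ξ (A.lieDual W η) ζ
  have e2 := hΦ.cyclic η (A.lieDual W ζ) ξ
  have e3 := hΦ.cyclic ζ (A.lieDual W ξ) η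
  have inv := i2 ξ η ζ
  -- Normal form: in every term the differentiated covector sits in the first slot of Φ, so that
  -- cyclic rotations match syntactically.
  rw [e1, ← hΦ.cyclic (A.lieDual W ζ) ξ η] at inv
  simp only [CourantStructure.T, twistedCourant, pairing_apply, Derivation.map_smul,
    LinearMap.add_apply, LinearMap.sub_apply, d_apply, lieDual_apply, map_sub, map_add,
    hΦ.anchor, hA.anchor_bracket, Derivation.add_apply, Derivation.zero_apply,
    Derivation.commutator_apply, i1, add_bracket, hA.leibniz]
  simp only [A.bracket_skew Y X, A.bracket_skew Z X, A.bracket_skew Z Y, map_neg]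
  simp only [Algebra.smul_def (R := ℂ) (A := R)]
  -- The scalars become elements of the commutative ring known only through 2c = 1 and 3t = 1, the
  -- two relations used in the final combination.
  generalize algebraMap ℂ R (1 / 2) = c at *
  generalize algebraMap ℂ R (1 / 3) = t at *
  simp only [e1, e2, e3, ← cyc2, ← cyc1, inv]
  linear_combination
    ((A.anchor W (A.anchor Z (ξ Y)) - A.anchor W (A.anchor Z (η X)) + A.anchor W (A.anchor X (η Z))
      - A.anchor W (A.anchor X (ζ Y)) + A.anchor W (A.anchor Y (ζ X))
      - A.anchor W (A.anchor Y (ξ Z))) * t * c - 2 * (ζ (Φ (A.lieDual W ξ) η)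
      + ξ (Φ (A.lieDual W η) ζ) + η (Φ (A.lieDual W ζ) ξ))) * hc
    - c * ((A.anchor W (A.anchor Z (ξ Y)) - A.anchor W (A.anchor Z (η X))
      + A.anchor W (A.anchor X (η Z)) - A.anchor W (A.anchor X (ζ Y))
      + A.anchor W (A.anchor Y (ζ X)) - A.anchor W (A.anchor Y (ξ Z))) * c
      + A.anchor W (ζ (A.bracket X Y)) + A.anchor W (ξ (A.bracket Y Z))
      - A.anchor W (η (A.bracket X Z)) + (ζ (Φ (A.lieDual W ξ) η)
      + ξ (Φ (A.lieDual W η) ζ) + η (Φ (A.lieDual W ζ) ξ))) * ht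

theorem twistedCourant_isCourantAlgebroid [Module.IsReflexive R Γ] (hA : A.IsLieAlgebroid)
    (hΦ : IsInvariantTrivector A Φ) : (twistedCourant A Φ).IsCourantAlgebroid where
  form_symm e₁ e₂ := by simp only [twistedCourant, pairing_apply, add_comm]
  form_nondegenerate := pairing_bijective
  bracket_add e₁ e₂ e₃ := by
    refine Prod.ext ?_ (LinearMap.ext fun Y => ?_)
    · simp only [twistedCourant, Prod.fst_add, Prod.snd_add, A.bracket_add, map_add]
      abel
    · simp only [twistedCourant, Prod.fst_add, Prod.snd_add, LinearMap.add_apply,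
        LinearMap.sub_apply, d_apply, lieDual_apply, map_sub, map_add, Derivation.map_smul,
        smul_sub, smul_add, Derivation.add_apply, add_bracket]
      abel
  bracket_skew := twistedCourant_bracket_skew hΦ
  form_D f e := by simp [twistedCourant, pairing_apply]
  jacobi e₁ e₂ e₃ := by
    refine Prod.ext ?_ (LinearMap.ext fun W => twistedCourant_jacobi_snd hA hΦ e₁ e₂ e₃ W)
    exact twistedCourant_jacobi_fst hA hΦ e₁.1 e₂.1 e₃.1 e₁.2 e₂.2 e₃.2
  anchor_bracket e₁ e₂ := by
    simp only [twistedCourant, LinearMap.comp_apply, LinearMap.fst_apply, map_add, hΦ.anchor,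
      hA.anchor_bracket, add_zero]
  bracket_smul e₁ f e₂ := by
    refine Prod.ext ?_ (LinearMap.ext fun Y => ?_)
    · simp only [twistedCourant, Prod.fst_add, Prod.fst_sub, Prod.smul_fst,
        Prod.smul_snd, A.bracket_smul, map_smul, LinearMap.comp_apply, LinearMap.fst_apply]
      simp only [smul_add, smul_zero, sub_zero]
      abel
    · have hh := half_add_half (R := R)
      simp only [Algebra.smul_def (R := ℂ)] at hh
      simp only [twistedCourant, Prod.snd_add, Prod.snd_sub, Prod.smul_fst,
        Prod.smul_snd, LinearMap.add_apply, LinearMap.sub_apply, LinearMap.smul_apply, d_apply,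
        lieDual_apply, map_sub, map_smul, Derivation.map_smul, pairing_apply,
        LinearMap.comp_apply, LinearMap.fst_apply, smul_bracket, Derivation.smul_apply,
        smul_eq_mul, Derivation.leibniz]
      simp only [Algebra.smul_def (R := ℂ) (A := R)]
      -- The term ⟨ξ₁, X₂⟩ a(Y) f has coefficient -1 from L_{fX₂} ξ₁ and 1/2 from the exact term,
      -- which leaves the -1/2 required by the pairing.
      linear_combination (e₁.2 e₂.1 * A.anchor Y f) * hh 1
  anchor_D f := by simp [twistedCourant]
  anchor_form e h₁ h₂ := by
    have hh := half_add_half (R := R)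
    have cyc1 := hΦ.cyclic e.2 h₁.2 h₂.2
    have cyc2 := hΦ.cyclic e.2 h₂.2 h₁.2
    rw [hΦ.skew h₂.2 h₁.2, map_neg] at cyc2
    simp only [Algebra.smul_def (R := ℂ)] at hh
    simp only [twistedCourant, LinearMap.add_apply, LinearMap.sub_apply,
      d_apply, lieDual_apply, map_sub, map_add, Derivation.map_smul,
      pairing_apply, LinearMap.comp_apply, LinearMap.fst_apply]
    simp only [A.bracket_skew h₂.1 h₁.1, map_neg]
    simp only [Algebra.smul_def (R := ℂ) (A := R), cyc1, cyc2]
    simp only [map_zero]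
    linear_combination -algebraMap ℂ R (1 / 2) * (hh (A.anchor h₂.1 (e.2 h₁.1))
      + hh (A.anchor h₁.1 (e.2 h₂.1)))

end Twisted

/-- The axioms of a Courant algebroid are transported along isomorphisms that intertwine `D`. -/
theorem CourantIso.isCourantAlgebroid {E E' : Type*} [AddCommGroup E] [Module R E]
    [AddCommGroup E'] [Module R E'] {C : CourantStructure R E} {C' : CourantStructure R E'}
    (τ : CourantIso C C') (hD : ∀ f, τ.toEquiv (C.D f) = C'.D f) (hC' : C'.IsCourantAlgebroid) :
    C.IsCourantAlgebroid where
  form_symm e₁ e₂ := by rw [← τ.map_form, hC'.form_symm, τ.map_form]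
  form_nondegenerate := by
    have h : (C.form : E → Module.Dual R E)
        = τ.toEquiv.dualMap ∘ (C'.form : E' → Module.Dual R E') ∘ τ.toEquiv := by
      funext e₁
      refine LinearMap.ext fun e₂ => ?_
      exact (τ.map_form e₁ e₂).symm
    rw [h]
    exact τ.toEquiv.dualMap.bijective.comp (hC'.form_nondegenerate.comp τ.toEquiv.bijective)
  bracket_add e₁ e₂ e₃ := τ.toEquiv.injective <| by
    simp only [map_add, τ.map_bracket, hC'.bracket_add]
  bracket_skew e₁ e₂ := τ.toEquiv.injective <| by
    rw [map_neg, τ.map_bracket, τ.map_bracket, hC'.bracket_skew]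
  form_D f e := by rw [← τ.map_form, hD, hC'.form_D, τ.map_anchor]
  jacobi e₁ e₂ e₃ := τ.toEquiv.injective <| by
    have hT : C.T e₁ e₂ e₃ = C'.T (τ.toEquiv e₁) (τ.toEquiv e₂) (τ.toEquiv e₃) := by
      simp only [CourantStructure.T, ← τ.map_bracket, τ.map_form]
    simp only [map_add, τ.map_bracket, hC'.jacobi, hD, hT]
  anchor_bracket e₁ e₂ := by
    rw [← τ.map_anchor, τ.map_bracket, hC'.anchor_bracket, τ.map_anchor, τ.map_anchor]
  bracket_smul e₁ f e₂ := τ.toEquiv.injective <| by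
    simp only [map_add, map_sub, map_smul, τ.map_bracket, hC'.bracket_smul, hD, τ.map_anchor,
      τ.map_form]
  anchor_D f := by rw [← τ.map_anchor, hD, hC'.anchor_D]
  anchor_form e h₁ h₂ := by
    have h : ∀ k, τ.toEquiv (C.bracket e k + C.D (C.form e k))
        = C'.bracket (τ.toEquiv e) (τ.toEquiv k) + C'.D (C'.form (τ.toEquiv e) (τ.toEquiv k)) :=
      fun k => by rw [map_add, τ.map_bracket, hD, τ.map_form]
    rw [← τ.map_anchor e, ← τ.map_form h₁ h₂, hC'.anchor_form, ← h, ← h, τ.map_form, τ.map_form]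

/-- The inverse of an isomorphism of Courant structures. -/
def CourantIso.symm {E E' : Type*} [AddCommGroup E] [Module R E]
    [AddCommGroup E'] [Module R E'] {C : CourantStructure R E} {C' : CourantStructure R E'}
    (τ : CourantIso C C') : CourantIso C' C where
  toEquiv := τ.toEquiv.symm
  map_bracket e₁ e₂ := τ.toEquiv.injective <| by simp [τ.map_bracket]
  map_form e₁ e₂ := by rw [← τ.map_form]; simp
  map_anchor e := by rw [← τ.map_anchor]; simp

/-- The composition of isomorphisms of Courant structures. -/
def CourantIso.trans {E E' E'' : Type*} [AddCommGroup E] [Module R E]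
    [AddCommGroup E'] [Module R E'] [AddCommGroup E''] [Module R E'']
    {C : CourantStructure R E} {C' : CourantStructure R E'} {C'' : CourantStructure R E''}
    (τ : CourantIso C C') (τ' : CourantIso C' C'') : CourantIso C C'' where
  toEquiv := τ.toEquiv.trans τ'.toEquiv
  map_bracket e₁ e₂ := by simp [τ.map_bracket, τ'.map_bracket]
  map_form e₁ e₂ := by simp [τ.map_form, τ'.map_form]
  map_anchor e := by simp [τ.map_anchor, τ'.map_anchor]

/-! ### Untwisting the double of a coboundary structure by a shear -/

section Coboundary

variable [Module.IsReflexive R Γ]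

variable (R) in
theorem eq_of_forall_dual {X Y : Γ} (h : ∀ η : Module.Dual R Γ, η X = η Y) : X = Y :=
  (Module.evalEquiv R Γ).injective (LinearMap.ext h)

@[simp] theorem apply_dStar (A' : AlmostLieAlgebroid R (Module.Dual R Γ)) (f : R)
    (η : Module.Dual R Γ) : η (dStar A' f) = A'.anchor η f := by
  simp [dStar]

@[simp] theorem apply_lieStar (A' : AlmostLieAlgebroid R (Module.Dual R Γ))
    (ξ η : Module.Dual R Γ) (X : Γ) :
    η (lieStar A' ξ X) = A'.anchor ξ (η X) - A'.bracket ξ η X := by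
  simp [lieStar]

variable (A : AlmostLieAlgebroid R Γ) (Λ : Bivector R Γ)

theorem coboundaryDual_bracket_apply (ξ η : Module.Dual R Γ) (X : Γ) :
    (coboundaryDual A Λ).bracket ξ η X = A.anchor (sharp Λ ξ) (η X)
      - η (A.bracket (sharp Λ ξ) X) - (A.anchor (sharp Λ η) (ξ X) - ξ (A.bracket (sharp Λ η) X))
      - A.anchor X (η (sharp Λ ξ)) := rfl

theorem dStar_coboundaryDual (f : R) : dStar (coboundaryDual A Λ) f = -sharp Λ (A.d f) := by
  refine eq_of_forall_dual R fun η => ?_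
  rw [apply_dStar, map_neg, sharp_skew Λ (A.d f) η, neg_neg]
  rfl

/-- Together with `dStar_coboundaryDual`, this expresses the bracket of the double through A and Λ^#
alone, ready for comparison after the shear. Pairing with η and moving Λ^# across by skewness
reduces it to the definition of [ξ, η]_Λ. -/
theorem lieStar_coboundaryDual (ξ : Module.Dual R Γ) (X : Γ) :
    lieStar (coboundaryDual A Λ) ξ X
      = A.bracket (sharp Λ ξ) X + sharp Λ (A.lieDual X ξ) - sharp Λ (A.d (ξ X)) := by
  refine eq_of_forall_dual R fun η => ?_
  rw [apply_lieStar, coboundaryDual_bracket_apply, map_sub, map_add,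
    sharp_skew Λ (A.lieDual X ξ) η, sharp_skew Λ (A.d _) η, sharp_skew Λ ξ η]
  simp only [lieDual_apply, d_apply, map_neg, A.bracket_skew (sharp Λ η) X]
  change A.anchor (sharp Λ ξ) (η X) - _ = _
  ring

variable {A Λ} {Φ : Module.Dual R Γ →ₗ[R] Module.Dual R Γ →ₗ[R] Γ}

/-- The shear `X + ξ ↦ (X + Λ^# ξ) + ξ`. -/
def shear (Λ : Bivector R Γ) : (Γ × Module.Dual R Γ) ≃ₗ[R] (Γ × Module.Dual R Γ) where
  toFun e := (e.1 + sharp Λ e.2, e.2)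
  invFun e := (e.1 - sharp Λ e.2, e.2)
  map_add' e e' := by
    refine Prod.ext ?_ rfl
    simp only [Prod.fst_add, Prod.snd_add, map_add]
    abel
  map_smul' f e := by
    refine Prod.ext ?_ rfl
    simp
  left_inv e := by simp
  right_inv e := by simp

/-- If `Φ` measures the failure of `Λ^#` to preserve brackets, then the shear along `Λ` identifies
the double of `(A, A^*, Λ)` with the standard Courant structure twisted by `Φ`. -/
def coboundaryDoubleIso
    (hΛ : ∀ ξ η, sharp Λ ((coboundaryDual A Λ).bracket ξ η)
      = A.bracket (sharp Λ ξ) (sharp Λ η) + Φ ξ η) :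
    CourantIso (coboundaryDouble A Λ) (twistedCourant A Φ) where
  toEquiv := shear Λ
  map_bracket e₁ e₂ := by
    have hd : ∀ f g : R, A.d (f + g) = A.d f + A.d g := fun f g =>
      LinearMap.ext fun Y => by simp
    have hd' : ∀ f g : R, A.d (f - g) = A.d f - A.d g := fun f g =>
      LinearMap.ext fun Y => by simp
    have hhalf : ∀ f : R, A.d ((1 / 2 : ℂ) • f) + A.d ((1 / 2 : ℂ) • f) = A.d f := fun f => by
      rw [← hd, half_add_half]
    have hl : ∀ (X Y : Γ) (ξ : Module.Dual R Γ), A.lieDual (X + Y) ξ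
        = A.lieDual X ξ + A.lieDual Y ξ := fun X Y ξ =>
      LinearMap.ext fun Z => by simp [add_bracket]; ring
    have h1 := hhalf (e₁.2 e₂.1)
    have h2 := hhalf (e₂.2 e₁.1)
    have h3 := hhalf (e₂.2 (sharp Λ e₁.2))
    have h12 := sharp_skew Λ e₂.2 e₁.2
    refine Prod.ext ?_ ?_
    · simp only [shear, coboundaryDouble, double, twistedCourant, LinearEquiv.coe_mk,
        LinearMap.coe_mk, AddHom.coe_mk, map_add, map_sub, hΛ, dStar_coboundaryDual,
        lieStar_coboundaryDual, smul_sub, hd', A.bracket_add, add_bracket]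
      -- Up to a common sign, Λ^# d⟨ξ, X⟩ occurs with coefficient -1 from L_ξ X, 1/2 from d_*, and
      -- 1/2 from the sheared exact term. Splitting the whole term into halves lets the three
      -- cancel.
      rw [← h1, ← h2]
      simp only [map_add]
      rw [A.bracket_skew (sharp Λ e₂.2) e₁.1]
      abel
    · simp only [shear, coboundaryDouble, double, twistedCourant, LinearEquiv.coe_mk,
        LinearMap.coe_mk, AddHom.coe_mk, map_add, smul_sub, smul_add, hd, hd', hl, h12]
      simp only [coboundaryDual]
      -- The shear changes ⟨ξ₁, X₂⟩ - ⟨ξ₂, X₁⟩ by -2 Λ(ξ₁, ξ₂); half of its differential is the term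
      -- -d(Λ(ξ₁, ξ₂)) of [ξ₁, ξ₂]_Λ.
      rw [← h3]
      have hn : A.d ((1 / 2 : ℂ) • -(e₂.2 (sharp Λ e₁.2)))
        = -A.d ((1 / 2 : ℂ) • e₂.2 (sharp Λ e₁.2)) := LinearMap.ext fun Z => by simp
      rw [hn]
      abel
  map_form e₁ e₂ := by
    have h12 := sharp_skew Λ e₂.2 e₁.2
    simp only [shear, twistedCourant, pairing_apply, LinearEquiv.coe_mk, LinearMap.coe_mk,
      AddHom.coe_mk, map_add, h12]
    change _ = (1 / 2 : ℂ) • (e₁.2 e₂.1 + e₂.2 e₁.1)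
    congr 1
    ring
  map_anchor e := by
    simp [shear, twistedCourant, coboundaryDouble, double, coboundaryDual]

/-- The shear intertwines the operators D: it sends (d_* f, df) to (d_* f + Λ^# df, df) = (0, df).
-/
theorem coboundaryDouble_isCourantAlgebroid (hA : A.IsLieAlgebroid)
    (hΦ : IsInvariantTrivector A Φ)
    (hΛ : ∀ ξ η, sharp Λ ((coboundaryDual A Λ).bracket ξ η)
      = A.bracket (sharp Λ ξ) (sharp Λ η) + Φ ξ η) :
    (coboundaryDouble A Λ).IsCourantAlgebroid :=
  (coboundaryDoubleIso hΛ).isCourantAlgebroid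
    (fun f => Prod.ext (by
      change dStar (coboundaryDual A Λ) f + sharp Λ (A.d f) = 0
      rw [dStar_coboundaryDual, neg_add_cancel]) rfl)
    (twistedCourant_isCourantAlgebroid hA hΦ)

/-- `d_* X = - L_X Λ` for a coboundary structure. -/
theorem dStarSection_coboundaryDual (X : Γ) (ξ η : Module.Dual R Γ) :
    dStarSection (coboundaryDual A Λ) X ξ η
      = -lieBivector A X (fun ξ η => η (sharp Λ ξ)) ξ η := by
  simp only [dStarSection, lieBivector, coboundaryDual_bracket_apply]
  rw [sharp_skew Λ (A.lieDual X ξ) η]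
  simp only [lieDual_apply, A.bracket_skew _ X, sharp_skew Λ ξ η, map_neg]
  change A.anchor (sharp Λ ξ) (η X) - A.anchor (sharp Λ η) (ξ X) - _ = _
  ring

/-- A^* is isotropic in the double and closed under its bracket, so T vanishes on it and the Courant
identity becomes Jacobi for [·, ·]_Λ. The anchor respects brackets because it kills Φ. Compatibility
is L_{[X, Y]} Λ = L_X L_Y Λ - L_Y L_X Λ. -/
theorem isCoboundaryLieBialgebroid (hA : A.IsLieAlgebroid)
    (hΦ : IsInvariantTrivector A Φ)
    (hΛ : ∀ ξ η, sharp Λ ((coboundaryDual A Λ).bracket ξ η)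
      = A.bracket (sharp Λ ξ) (sharp Λ η) + Φ ξ η) :
    IsCoboundaryLieBialgebroid A Λ where
  isLie := hA
  isLie_dual :=
    { jacobi := fun ξ η ζ => by
        have hC := coboundaryDouble_isCourantAlgebroid hA hΦ hΛ
        have hb : ∀ ξ η : Module.Dual R Γ, (coboundaryDouble A Λ).bracket (0, ξ) (0, η)
            = (0, (coboundaryDual A Λ).bracket ξ η) := fun ξ η => by
          refine Prod.ext ?_ ?_
          · refine eq_of_forall_dual R fun ζ => ?_
            simp [coboundaryDouble, double]
          · refine LinearMap.ext fun Z => ?_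
            simp [coboundaryDouble, double]
        have hf : ∀ ξ η : Module.Dual R Γ, (coboundaryDouble A Λ).form (0, ξ) (0, η) = 0 :=
          fun ξ η => by simp [coboundaryDouble, double]
        have := congrArg Prod.snd (hC.jacobi (0, ξ) (0, η) (0, ζ))
        simp only [hb, CourantStructure.T, hf, add_zero, smul_zero] at this
        refine this.trans (LinearMap.ext fun Z => ?_)
        simp [coboundaryDouble, double]
      anchor_bracket := fun ξ η => by
        change A.anchor (sharp Λ _) = ⁅A.anchor (sharp Λ ξ), A.anchor (sharp Λ η)⁆
        rw [hΛ, map_add, hΦ.anchor, add_zero, hA.anchor_bracket] }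
  compat X Y ξ η := by
    have hP : ∀ X, dStarSection (coboundaryDual A Λ) X
        = -lieBivector A X (fun ξ η => η (sharp Λ ξ)) := fun X =>
      funext fun ξ => funext fun η => dStarSection_coboundaryDual X ξ η
    have hl : ∀ ξ, A.lieDual (A.bracket X Y) ξ
        = A.lieDual X (A.lieDual Y ξ) - A.lieDual Y (A.lieDual X ξ) := fun ξ => by
      refine LinearMap.ext fun Z => ?_
      simp only [LinearMap.sub_apply, lieDual_apply, hA.anchor_bracket,
        Derivation.commutator_apply, hA.leibniz, map_sub]
      ring
    simp only [hP]
    simp only [lieBivector, Pi.neg_apply, map_neg, hl, hA.anchor_bracket, Derivation.commutator_apply, map_sub,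
      LinearMap.sub_apply]
    ring

end Coboundary

end Abstract

/-! ### Calculus of holomorphic functions and vector fields -/

section Calculus

variable {ι : Type*} [Fintype ι] {U : Opens (ι → ℂ)}
variable {V W : Type*} [AddCommGroup V] [Module ℂ V] [AddCommGroup W] [Module ℂ W]

namespace Hol

@[simp] theorem comp_const (φ : Module.Dual ℂ V) (v : V) :
    comp φ (const U v) = algebraMap ℂ (𝒪 U) (φ v) := rfl

theorem ext_comp [Module.Finite ℂ V] {f g : Hol U V} (h : ∀ φ, comp φ f = comp φ g) : f = g := by
  rw [← sum_comp_coord f, ← sum_comp_coord g]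
  simp only [h]

/-- Postcomposition with a linear map. -/
def map (T : V →ₗ[ℂ] W) : Hol U V →ₗ[𝒪 U] Hol U W where
  toFun f := ⟨fun x => T (f.1 x), fun φ => f.2 (φ ∘ₗ T)⟩
  map_add' f g := ext fun x => T.map_add (f.1 x) (g.1 x)
  map_smul' c f := ext fun x => T.map_smul (c.1 x) (f.1 x)

theorem map_apply (T : V →ₗ[ℂ] W) (f : Hol U V) (x : U) : (map T f).1 x = T (f.1 x) := rfl

@[simp] theorem comp_map (φ : Module.Dual ℂ W) (T : V →ₗ[ℂ] W) (f : Hol U V) :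
    comp φ (map T f) = comp (φ ∘ₗ T) f := rfl

theorem const_add (v w : V) : const U (v + w) = const U v + const U w := rfl

theorem const_zero : const U (0 : V) = 0 := rfl

theorem const_sum {κ : Type*} (s : Finset κ) (v : κ → V) :
    const U (∑ k ∈ s, v k) = ∑ k ∈ s, const U (v k) :=
  map_sum (⟨⟨const U, const_zero⟩, const_add⟩ : V →+ Hol U V) v s

theorem const_smul (c : ℂ) (v : V) : const U (c • v) = algebraMap ℂ (𝒪 U) c • const U v := rfl

theorem comp_eq_sum [Module.Finite ℂ V] (φ : Module.Dual ℂ V) (f : Hol U V) :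
    comp φ f = ∑ j, algebraMap ℂ (𝒪 U) (φ (Module.finBasis ℂ V j))
      * comp ((Module.finBasis ℂ V).coord j) f := by
  conv_lhs => rw [← sum_comp_coord f]
  simp [mul_comm]

/-- A bilinear form applied pointwise. -/
def pair [Module.Finite ℂ V] [Module.Finite ℂ W] (β : V →ₗ[ℂ] W →ₗ[ℂ] ℂ) (f : Hol U V)
    (g : Hol U W) : 𝒪 U :=
  ∑ j, comp ((Module.finBasis ℂ V).coord j) f * comp (β (Module.finBasis ℂ V j)) g

theorem pair_apply [Module.Finite ℂ V] [Module.Finite ℂ W] (β : V →ₗ[ℂ] W →ₗ[ℂ] ℂ) (f : Hol U V)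
    (g : Hol U W) (x : U) : (pair β f g).1 x = β (f.1 x) (g.1 x) := by
  have h : (pair β f g).1 x = ∑ j, (Module.finBasis ℂ V).coord j (f.1 x)
      * β (Module.finBasis ℂ V j) (g.1 x) := by
    have := map_sum (Pi.evalRingHom (fun _ : U => ℂ) x |>.comp (holSubalgebra U).val.toRingHom)
      (fun j => comp ((Module.finBasis ℂ V).coord j) f * comp (β (Module.finBasis ℂ V j)) g)
      Finset.univ
    exact this
  rw [h]
  conv_rhs => rw [← (Module.finBasis ℂ V).sum_repr (f.1 x)]
  simp only [map_sum, LinearMap.sum_apply, map_smul, LinearMap.smul_apply, smul_eq_mul,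
    Module.Basis.coord_apply]

end Hol

variable [DecidableEq ι]

/-- Both sides are entries of the second derivative, which is symmetric for an analytic function. -/
theorem partialDeriv_comm (i j : ι) (f : 𝒪 U) :
    partialDeriv i (partialDeriv j f) = partialDeriv j (partialDeriv i f) := by
  have key : ∀ (i j : ι) (x : U), (partialDeriv i (partialDeriv j f)).1 x
      = fderiv ℂ (fderiv ℂ (extendZero f.1)) x (Pi.single i 1) (Pi.single j 1) := fun i j x => by
    -- The two functions may differ outside U, but agreement near a point of the open set U
    -- determines the derivative there.
    have h : (fun y => fderiv ℂ (extendZero f.1) y (Pi.single j 1)) =ᶠ[nhds (x : ι → ℂ)]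
        extendZero (partialDeriv j f).1 := eventuallyEq_extendZero _ _ (fun y => rfl) x
    change fderiv ℂ (extendZero (partialDeriv j f).1) x (Pi.single i 1) = _
    rw [← h.fderiv_eq, fderiv_clm_apply (f.2 x).fderiv.differentiableAt
      (differentiableAt_const _)]
    simp
  refine 𝒪.ext fun x => ?_
  rw [key, key]
  have := ((f.2 x).contDiffAt (n := ⊤)).isSymmSndFDerivAt (by simp)
  exact this _ _

theorem vectorField_apply (X : ι → 𝒪 U) (f : 𝒪 U) :
    vectorField X f = ∑ i, X i * partialDeriv i f := by
  have := map_sum (Derivation.coeFnAddMonoidHom (R := ℂ) (A := 𝒪 U) (M := 𝒪 U))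
    (fun i => X i • partialDeriv i) Finset.univ
  refine (congrFun this f).trans ?_
  rw [Finset.sum_apply]
  rfl

/-- The second-order terms of the two compositions coincide by symmetry of mixed partial derivatives
and drop out of the commutator. -/
theorem vectorField_bracket (X Y : ι → 𝒪 U) :
    vectorField (fun j => vectorField X (Y j) - vectorField Y (X j))
      = ⁅vectorField X, vectorField Y⁆ := by
  have key : ∀ (X Y : ι → 𝒪 U) (f : 𝒪 U), vectorField X (vectorField Y f)
      = ∑ j, vectorField X (Y j) * partialDeriv j f
        + ∑ j, ∑ i, Y j * X i * partialDeriv i (partialDeriv j f) := fun X Y f => by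
    rw [vectorField_apply Y f, map_sum, ← Finset.sum_add_distrib]
    refine Finset.sum_congr rfl fun j _ => ?_
    rw [Derivation.leibniz, vectorField_apply X (partialDeriv j f), smul_eq_mul, smul_eq_mul,
      Finset.mul_sum, add_comm, mul_comm]
    simp only [mul_assoc]
  refine Derivation.ext fun f => ?_
  rw [Derivation.commutator_apply, key, key, vectorField_apply]
  have hs : ∑ j, ∑ i, X j * Y i * partialDeriv i (partialDeriv j f)
      = ∑ j, ∑ i, Y j * X i * partialDeriv i (partialDeriv j f) := by
    rw [Finset.sum_comm]
    refine Finset.sum_congr rfl fun j _ => Finset.sum_congr rfl fun i _ => ?_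
    rw [partialDeriv_comm, mul_comm (X i)]
  rw [hs]
  simp only [sub_mul, Finset.sum_sub_distrib]
  ring

variable [Module.Finite ℂ V] [Module.Finite ℂ W]

/-- Frees the derivative from the basis used to define it; with `Hol.ext_comp`, identities for
vector-valued maps reduce to scalar ones. -/
theorem Hol.comp_partialDeriv (φ : Module.Dual ℂ V) (i : ι) (f : Hol U V) :
    Hol.comp φ (Hol.partialDeriv i f) = DynR.partialDeriv i (Hol.comp φ f) := by
  rw [Hol.comp_eq_sum φ f, Hol.partialDeriv]
  simp only [map_sum, map_smul, comp_const, Derivation.leibniz, Derivation.map_algebraMap,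
    smul_eq_mul, mul_zero, add_zero]
  exact Finset.sum_congr rfl fun j _ => mul_comm _ _

@[simp] theorem Hol.comp_lieFun (φ : Module.Dual ℂ V) (X : ι → 𝒪 U) (f : Hol U V) :
    Hol.comp φ (lieFun X f) = vectorField X (Hol.comp φ f) := by
  simp [lieFun, vectorField_apply, Hol.comp_partialDeriv]

@[simp] theorem lieFun_const (X : ι → 𝒪 U) (v : V) : lieFun X (Hol.const U v) = 0 :=
  Hol.ext_comp fun φ => by simp

@[simp] theorem zero_lieFun (f : Hol U V) : lieFun (0 : ι → 𝒪 U) f = 0 := by simp [lieFun]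

theorem lieFun_sub (X : ι → 𝒪 U) (f g : Hol U V) : lieFun X (f - g) = lieFun X f - lieFun X g :=
  Hol.ext_comp fun φ => by simp

/-- Applied to the Killing form and, through `Hol.comp_lie`, to the components of the Lie bracket.
-/
theorem vectorField_pair (β : V →ₗ[ℂ] W →ₗ[ℂ] ℂ) (X : ι → 𝒪 U) (f : Hol U V) (g : Hol U W) :
    vectorField X (Hol.pair β f g) = Hol.pair β (lieFun X f) g + Hol.pair β f (lieFun X g) := by
  simp only [Hol.pair, map_sum, Derivation.leibniz, Hol.comp_lieFun, ← Finset.sum_add_distrib,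
    smul_eq_mul]
  exact Finset.sum_congr rfl fun j _ => by ring

theorem lieFun_map (T : V →ₗ[ℂ] W) (X : ι → 𝒪 U) (f : Hol U V) :
    lieFun X (Hol.map T f) = Hol.map T (lieFun X f) :=
  Hol.ext_comp fun φ => by simp

theorem lieFun_lieFun (X Y : ι → 𝒪 U) (f : Hol U V) :
    lieFun (fun j => vectorField X (Y j) - vectorField Y (X j)) f
      = lieFun X (lieFun Y f) - lieFun Y (lieFun X f) :=
  Hol.ext_comp fun φ => by simp [vectorField_bracket, Derivation.commutator_apply]

end Calculus

/-! ### The gauge algebroid is a Lie algebroid -/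

section Gauge

variable {ι : Type*} [Fintype ι] {U : Opens (ι → ℂ)}
variable {𝔤 : Type*} [LieRing 𝔤] [LieAlgebra ℂ 𝔤] [Module.Finite ℂ 𝔤]

theorem Hol.lie_apply (f g : Hol U 𝔤) (x : U) : (Hol.lie f g).1 x = ⁅f.1 x, g.1 x⁆ := rfl

theorem Hol.add_lie (f g k : Hol U 𝔤) : Hol.lie (f + g) k = Hol.lie f k + Hol.lie g k :=
  Hol.ext fun x => _root_.add_lie (f.1 x) (g.1 x) (k.1 x)

theorem Hol.lie_neg (f g : Hol U 𝔤) : Hol.lie f (-g) = -Hol.lie f g :=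
  Hol.ext fun x => _root_.lie_neg (f.1 x) (g.1 x)

theorem Hol.sub_lie (f g k : Hol U 𝔤) : Hol.lie (f - g) k = Hol.lie f k - Hol.lie g k :=
  Hol.ext fun x => _root_.sub_lie (f.1 x) (g.1 x) (k.1 x)

theorem Hol.smul_lie (c : 𝒪 U) (f g : Hol U 𝔤) : Hol.lie (c • f) g = c • Hol.lie f g :=
  Hol.ext fun x => _root_.smul_lie (c.1 x) (f.1 x) (g.1 x)

theorem Hol.lie_jacobi (f g k : Hol U 𝔤) :
    Hol.lie (Hol.lie f g) k + Hol.lie (Hol.lie g k) f + Hol.lie (Hol.lie k f) g = 0 :=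
  Hol.ext fun x => by
    have h := _root_.lie_jacobi (f.1 x) (g.1 x) (k.1 x)
    rw [← _root_.lie_skew (f.1 x) ⁅g.1 x, k.1 x⁆, ← _root_.lie_skew (g.1 x) ⁅k.1 x, f.1 x⁆,
      ← _root_.lie_skew (k.1 x) ⁅f.1 x, g.1 x⁆] at h
    change ⁅⁅f.1 x, g.1 x⁆, k.1 x⁆ + ⁅⁅g.1 x, k.1 x⁆, f.1 x⁆ + ⁅⁅k.1 x, f.1 x⁆, g.1 x⁆ = 0
    rw [← neg_eq_zero, ← h]
    abel

theorem Hol.comp_lie (φ : Module.Dual ℂ 𝔤) (f g : Hol U 𝔤) :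
    Hol.comp φ (Hol.lie f g)
      = Hol.pair ((LieModule.toEnd ℂ 𝔤 𝔤 : 𝔤 →ₗ[ℂ] Module.End ℂ 𝔤).compr₂ φ) f g :=
  𝒪.ext fun x => by rw [Hol.pair_apply]; rfl

variable [DecidableEq ι]

theorem lieFun_lie (X : ι → 𝒪 U) (f g : Hol U 𝔤) :
    lieFun X (Hol.lie f g) = Hol.lie (lieFun X f) g + Hol.lie f (lieFun X g) :=
  Hol.ext_comp fun φ => by
    rw [Hol.comp_lieFun, map_add, Hol.comp_lie, Hol.comp_lie, Hol.comp_lie, vectorField_pair]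

theorem gaugeAlgebroid_bracket (a b : GaugeSections U 𝔤) : (gaugeAlgebroid U 𝔤).bracket a b
    = (fun j => vectorField a.1 (b.1 j) - vectorField b.1 (a.1 j),
      Hol.lie a.2 b.2 + lieFun a.1 b.2 - lieFun b.1 a.2) := rfl

theorem gaugeAlgebroid_anchor (a : GaugeSections U 𝔤) :
    (gaugeAlgebroid U 𝔤).anchor a = vectorField a.1 := rfl

/-- The 𝔤-part of Jacobi combines the pointwise Jacobi identity with two facts: L_X is a derivation
of the pointwise bracket, and L_{[X, Y]} = [L_X, L_Y]. -/
theorem gaugeAlgebroid_isLieAlgebroid : (gaugeAlgebroid U 𝔤).IsLieAlgebroid where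
  jacobi a b c := by
    refine Prod.ext (funext fun j => ?_) ?_
    · simp only [gaugeAlgebroid_bracket, Prod.fst_add, Pi.add_apply, vectorField_bracket,
        Derivation.commutator_apply, map_sub, Prod.fst_zero, Pi.zero_apply]
      ring
    · simp only [gaugeAlgebroid_bracket, Prod.snd_add, lieFun_lieFun, lieFun_lie, lieFun_add,
        lieFun_sub, Hol.add_lie, Hol.sub_lie]
      rw [Hol.lie_skew a.2 (lieFun c.1 b.2), Hol.lie_skew b.2 (lieFun a.1 c.2),
        Hol.lie_skew c.2 (lieFun b.1 a.2), Prod.snd_zero, ← Hol.lie_jacobi a.2 b.2 c.2]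
      abel
  anchor_bracket a b := vectorField_bracket a.1 b.1

end Gauge

/-! ### Contractions of tensors with covectors -/

section Contraction

variable {R M : Type*} [CommRing R] [AddCommGroup M] [Module R M]

/-- Contraction of the first slot. -/
def contractLeft (φ : Module.Dual R M) : M ⊗[R] M →ₗ[R] M :=
  (TensorProduct.lid R M).toLinearMap ∘ₗ LinearMap.rTensor M φ

/-- Contraction of the second slot. -/
def contractRight (φ : Module.Dual R M) : M ⊗[R] M →ₗ[R] M :=
  (TensorProduct.rid R M).toLinearMap ∘ₗ LinearMap.lTensor M φ

@[simp] theorem contractLeft_tmul (φ : Module.Dual R M) (x y : M) :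
    contractLeft φ (x ⊗ₜ[R] y) = φ x • y := by simp [contractLeft]

@[simp] theorem contractRight_tmul (φ : Module.Dual R M) (x y : M) :
    contractRight φ (x ⊗ₜ[R] y) = φ y • x := by simp [contractRight]

theorem sharp_eq_contractLeft (Λ : Bivector R M) (φ : Module.Dual R M) :
    sharp Λ φ = contractLeft φ (Λ : M ⊗[R] M) := rfl

theorem contractLeft_comm (φ : Module.Dual R M) (t : M ⊗[R] M) :
    contractLeft φ (TensorProduct.comm R M M t) = contractRight φ t := by
  induction t with
  | zero => simp
  | tmul x y => simp
  | add x y hx hy => simp only [map_add, hx, hy]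

theorem comm_bivector (Λ : Bivector R M) :
    TensorProduct.comm R M M (Λ : M ⊗[R] M) = -(Λ : M ⊗[R] M) :=
  eq_neg_of_add_eq_zero_left Λ.2

theorem contractRight_bivector (Λ : Bivector R M) (φ : Module.Dual R M) :
    contractRight φ (Λ : M ⊗[R] M) = -sharp Λ φ := by
  rw [← contractLeft_comm, comm_bivector, map_neg, sharp_eq_contractLeft]

theorem sharp_add (Λ Λ' : Bivector R M) (φ : Module.Dual R M) :
    sharp (Λ + Λ') φ = sharp Λ φ + sharp Λ' φ := map_add (contractLeft φ) _ _

theorem sharp_smul (c : R) (Λ : Bivector R M) (φ : Module.Dual R M) :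
    sharp (c • Λ) φ = c • sharp Λ φ := map_smul (contractLeft φ) _ _

theorem sharp_sum {κ : Type*} (s : Finset κ) (Λ : κ → Bivector R M) (φ : Module.Dual R M) :
    sharp (∑ i ∈ s, Λ i) φ = ∑ i ∈ s, sharp (Λ i) φ := by
  simp only [sharp_eq_contractLeft, Submodule.coe_sum, map_sum]

theorem sharp_wedge (X Y : M) (φ : Module.Dual R M) :
    sharp (wedge R X Y) φ = φ X • Y - φ Y • X := by
  simp [sharp_eq_contractLeft, wedge]

/-- Contraction of the three slots of a tensor. -/
def contract₃ (φ ψ χ : Module.Dual R M) : M ⊗[R] (M ⊗[R] M) →ₗ[R] R :=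
  (TensorProduct.lid R R).toLinearMap ∘ₗ TensorProduct.map φ
    ((TensorProduct.lid R R).toLinearMap ∘ₗ TensorProduct.map ψ χ)

@[simp] theorem contract₃_tmul (φ ψ χ : Module.Dual R M) (x y z : M) :
    contract₃ φ ψ χ (x ⊗ₜ[R] (y ⊗ₜ[R] z)) = φ x * (ψ y * χ z) := by simp [contract₃]

theorem contract₃_tmul_left (φ ψ χ : Module.Dual R M) (x : M) (t : M ⊗[R] M) :
    contract₃ φ ψ χ (x ⊗ₜ[R] t) = φ x * χ (contractLeft ψ t) := by
  induction t with
  | zero => simp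
  | tmul y z => simp
  | add y z hy hz => simp only [TensorProduct.tmul_add, map_add, hy, hz, mul_add]

theorem contract₃_mk (φ ψ χ : Module.Dual R M) (x : M) (t : M ⊗[R] M) :
    contract₃ φ ψ χ (LinearMap.lTensor M (TensorProduct.mk R M M x) t)
      = ψ x * χ (contractLeft φ t) := by
  induction t with
  | zero => simp
  | tmul y z => simp; ring
  | add y z hy hz => simp only [map_add, hy, hz, mul_add]

theorem contract₃_mk_flip (φ ψ χ : Module.Dual R M) (x : M) (t : M ⊗[R] M) :
    contract₃ φ ψ χ (LinearMap.lTensor M ((TensorProduct.mk R M M).flip x) t)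
      = χ x * ψ (contractLeft φ t) := by
  induction t with
  | zero => simp
  | tmul y z => simp; ring
  | add y z hy hz => simp only [map_add, hy, hz, mul_add]

end Contraction

/-! ### Contracted Yang-Baxter terms and the Killing form -/

section Lie

variable {𝔤 : Type*} [LieRing 𝔤] [LieAlgebra ℂ 𝔤]

@[simp] theorem brk_tmul (x y : 𝔤) : brk (x ⊗ₜ[ℂ] y) = ⁅x, y⁆ := by simp [brk]

theorem contract₃_lie1213 (φ ψ χ : Module.Dual ℂ 𝔤) (s t : 𝔤 ⊗[ℂ] 𝔤) :
    contract₃ φ ψ χ (lie1213 s t) = φ ⁅contractRight ψ s, contractRight χ t⁆ := by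
  unfold lie1213
  induction s with
  | zero => simp
  | add s s' hs hs' => simp only [TensorProduct.add_tmul, map_add, hs, hs', add_lie]
  | tmul x y =>
    induction t with
    | zero => simp
    | add t t' ht ht' => simp only [TensorProduct.tmul_add, map_add, ht, ht', lie_add]
    | tmul z w => simp; ring

theorem contract₃_lie1223 (φ ψ χ : Module.Dual ℂ 𝔤) (s t : 𝔤 ⊗[ℂ] 𝔤) :
    contract₃ φ ψ χ (lie1223 s t) = ψ ⁅contractLeft φ s, contractRight χ t⁆ := by
  unfold lie1223
  induction s with
  | zero => simp
  | add s s' hs hs' => simp only [TensorProduct.add_tmul, map_add, hs, hs', add_lie]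
  | tmul x y =>
    induction t with
    | zero => simp
    | add t t' ht ht' => simp only [TensorProduct.tmul_add, map_add, ht, ht', lie_add]
    | tmul z w => simp; ring

theorem contract₃_lie1323 (φ ψ χ : Module.Dual ℂ 𝔤) (s t : 𝔤 ⊗[ℂ] 𝔤) :
    contract₃ φ ψ χ (lie1323 s t) = χ ⁅contractLeft φ s, contractLeft ψ t⁆ := by
  unfold lie1323
  induction s with
  | zero => simp
  | add s s' hs hs' => simp only [TensorProduct.add_tmul, map_add, hs, hs', add_lie]
  | tmul x y =>
    induction t with
    | zero => simp
    | add t t' ht ht' => simp only [TensorProduct.tmul_add, map_add, ht, ht', lie_add]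
    | tmul z w => simp; ring

/-- Each summand has its bracket in a different slot. A right contraction of a bivector is minus a
left one: the two signs of the first summand cancel, and the single sign of the second reverses its
bracket. -/
theorem contract₃_halfSchouten (φ ψ χ : Module.Dual ℂ 𝔤) (t : Bivector ℂ 𝔤) :
    contract₃ φ ψ χ (halfSchouten (t : 𝔤 ⊗[ℂ] 𝔤))
      = φ ⁅sharp t ψ, sharp t χ⁆ + ψ ⁅sharp t χ, sharp t φ⁆ + χ ⁅sharp t φ, sharp t ψ⁆ := by
  simp only [halfSchouten, map_add, contract₃_lie1213, contract₃_lie1223, contract₃_lie1323,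
    contractRight_bivector, ← sharp_eq_contractLeft, lie_neg, neg_lie, neg_neg]
  rw [← lie_skew (sharp t χ) (sharp t φ)]

theorem contractLeft_lie (φ : Module.Dual ℂ 𝔤) (y : 𝔤) (t : 𝔤 ⊗[ℂ] 𝔤) :
    contractLeft φ ⁅y, t⁆
      = ⁅y, contractLeft φ t⁆ + contractLeft (φ ∘ₗ LieAlgebra.ad ℂ 𝔤 y) t := by
  induction t with
  | zero => simp
  | add t t' ht ht' => simp only [lie_add, map_add, ht, ht']; abel
  | tmul z w => simp [TensorProduct.LieModule.lie_tmul_right]; abel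

/-- Invariance reads [y, t^# φ] + t^#(φ ∘ ad y) = 0; pair with ψ and use the skewness of t in the
second term. -/
theorem sharp_invariant {y : 𝔤} {t : Bivector ℂ 𝔤} (h : ⁅y, (t : 𝔤 ⊗[ℂ] 𝔤)⁆ = 0)
    (φ ψ : Module.Dual ℂ 𝔤) : ψ ⁅y, sharp t φ⁆ = φ ⁅y, sharp t ψ⁆ := by
  have h1 := congrArg ψ (congrArg (contractLeft φ) h)
  rw [contractLeft_lie, map_zero, map_zero, map_add, ← sharp_eq_contractLeft,
    ← sharp_eq_contractLeft, sharp_skew] at h1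
  rw [← sub_eq_zero, ← h1, sub_eq_add_neg]
  rfl

variable [Module.Finite ℂ 𝔤] [LieAlgebra.IsKilling ℂ 𝔤]

variable (𝔤) in
/-- The basis dual to the chosen basis with respect to the Killing form. -/
abbrev killingBasis : Module.Basis (Fin (Module.finrank ℂ 𝔤)) ℂ 𝔤 :=
  LinearMap.BilinForm.dualBasis (killingForm ℂ 𝔤)
    (LieAlgebra.IsKilling.killingForm_nondegenerate ℂ 𝔤) (Module.finBasis ℂ 𝔤)

theorem killingForm_killingBasis (j : Fin (Module.finrank ℂ 𝔤)) :
    killingForm ℂ 𝔤 (killingBasis 𝔤 j) = (Module.finBasis ℂ 𝔤).coord j := by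
  refine (Module.finBasis ℂ 𝔤).ext fun k => ?_
  rw [LinearMap.BilinForm.apply_dualBasis_left]
  simp [Finsupp.single_apply]

theorem eq_of_forall_killingForm {x y : 𝔤} (h : ∀ z, killingForm ℂ 𝔤 x z = killingForm ℂ 𝔤 y z) :
    x = y :=
  LinearMap.ker_eq_bot.1 (LieAlgebra.IsKilling.ker_killingForm_eq_bot ℂ 𝔤) (LinearMap.ext h)

theorem killingForm_lie_cycle (x y z : 𝔤) :
    killingForm ℂ 𝔤 z ⁅x, y⁆ = killingForm ℂ 𝔤 x ⁅y, z⁆ := by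
  rw [LieModule.traceForm_comm, LieModule.traceForm_apply_lie_apply]

/-- The identification `𝔤^* → 𝔤` by the Killing form. -/
def killingVec (φ : Module.Dual ℂ 𝔤) : 𝔤 := contractLeft φ (casimir 𝔤)

theorem killingVec_eq (φ : Module.Dual ℂ 𝔤) :
    killingVec φ = ∑ j, φ (Module.finBasis ℂ 𝔤 j) • killingBasis 𝔤 j := by
  simp [killingVec, casimir]

@[simp] theorem killingForm_killingVec (φ : Module.Dual ℂ 𝔤) (y : 𝔤) :
    killingForm ℂ 𝔤 (killingVec φ) y = φ y := by
  rw [killingVec_eq]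
  simp only [map_sum, map_smul, LinearMap.sum_apply, LinearMap.smul_apply,
    killingForm_killingBasis, smul_eq_mul]
  conv_rhs => rw [← (Module.finBasis ℂ 𝔤).sum_repr y]
  simp only [map_sum, map_smul, smul_eq_mul, mul_comm, Module.Basis.coord_apply]

/-- Symmetry of the Casimir element, from the expansion y = ∑ κ(b_j, y) b^j in the dual basis. -/
theorem contractRight_casimir (φ : Module.Dual ℂ 𝔤) :
    contractRight φ (casimir 𝔤) = killingVec φ := by
  have h : ∀ y, ∑ j, killingForm ℂ 𝔤 (Module.finBasis ℂ 𝔤 j) y • killingBasis 𝔤 j = y := fun y => by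
    refine eq_of_forall_killingForm fun z => ?_
    have := killingForm_killingVec (killingForm ℂ 𝔤 y) z
    rw [killingVec_eq] at this
    simpa only [LieModule.traceForm_comm ℂ 𝔤 𝔤 y] using this
  refine eq_of_forall_killingForm fun y => ?_
  rw [killingForm_killingVec]
  conv_rhs => rw [← h y]
  simp [casimir]
  exact Finset.sum_congr rfl fun j _ => mul_comm _ _

theorem contract₃_casimir (φ ψ χ : Module.Dual ℂ 𝔤) :
    contract₃ φ ψ χ (lie1223 (casimir 𝔤) (casimir 𝔤)) = ψ ⁅killingVec φ, killingVec χ⁆ := by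
  rw [contract₃_lie1223, contractRight_casimir]
  rfl

end Lie

/-! ### The invariant trivector of the Casimir element -/

section Trivector

variable {ι : Type*} [Fintype ι] {U : Opens (ι → ℂ)}
variable {𝔤 : Type*} [LieRing 𝔤] [LieAlgebra ℂ 𝔤] [Module.Finite ℂ 𝔤] [LieAlgebra.IsKilling ℂ 𝔤]

/-- The identification of the `𝔤^*`-part of a section of `A^*` with a `𝔤`-valued function by the
Killing form. -/
def killingSection : Module.Dual (𝒪 U) (GaugeSections U 𝔤) →ₗ[𝒪 U] Hol U 𝔤 :=
  ∑ j, ((LinearMap.applyₗ (constSection (U := U) (Module.finBasis ℂ 𝔤 j))).smulRight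
    (Hol.const U (killingBasis 𝔤 j)))

theorem killingSection_apply (ξ : Module.Dual (𝒪 U) (GaugeSections U 𝔤)) :
    killingSection ξ
      = ∑ j, ξ (constSection (Module.finBasis ℂ 𝔤 j)) • Hol.const U (killingBasis 𝔤 j) := by
  simp [killingSection, LinearMap.sum_apply]

/-- The basis-free characterisation of `killingSection`; by nondegeneracy of the Killing form it
determines it. -/
theorem pair_killingSection (ξ : Module.Dual (𝒪 U) (GaugeSections U 𝔤)) (f : Hol U 𝔤) :
    Hol.pair (killingForm ℂ 𝔤) (killingSection ξ) f = ξ (0, f) := by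
  have h1 : Hol.pair (killingForm ℂ 𝔤) (killingSection ξ) f
      = ∑ j, ξ (constSection (Module.finBasis ℂ 𝔤 j))
        * Hol.comp ((Module.finBasis ℂ 𝔤).coord j) f := by
    have h2 : ∀ v : 𝔤, Hol.pair (killingForm ℂ 𝔤) (Hol.const U v) f
        = Hol.comp (killingForm ℂ 𝔤 v) f := fun v => 𝒪.ext fun x => Hol.pair_apply _ _ _ _
    simp only [← killingForm_killingBasis, ← h2, killingSection_apply]
    simp only [Hol.pair, map_sum, map_smul, Finset.sum_mul, Finset.mul_sum, smul_eq_mul, mul_assoc]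
    exact Finset.sum_comm
  have h3 : ((0, f) : GaugeSections U 𝔤) = ∑ j, Hol.comp ((Module.finBasis ℂ 𝔤).coord j) f
      • constSection (Module.finBasis ℂ 𝔤 j) := by
    conv_lhs => rw [← Hol.sum_comp_coord f]
    simp only [constSection]
    refine Prod.ext ?_ ?_
    · simp [Prod.fst_sum]
    · simp [Prod.snd_sum]
  rw [h1, h3, map_sum]
  simp only [map_smul, smul_eq_mul, mul_comm]

theorem eq_of_forall_pair_killingForm {f g : Hol U 𝔤}
    (h : ∀ k, Hol.pair (killingForm ℂ 𝔤) f k = Hol.pair (killingForm ℂ 𝔤) g k) : f = g := by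
  refine Hol.ext fun x => eq_of_forall_killingForm fun z => ?_
  have := congrArg (fun F : 𝒪 U => F.1 x) (h (Hol.const U z))
  rwa [Hol.pair_apply, Hol.pair_apply] at this

variable (U 𝔤) in
/-- The trivector `[Ω¹², Ω²³]` up to sign, as a bilinear map. -/
def casimirTrivector : Module.Dual (𝒪 U) (GaugeSections U 𝔤) →ₗ[𝒪 U]
    Module.Dual (𝒪 U) (GaugeSections U 𝔤) →ₗ[𝒪 U] GaugeSections U 𝔤 :=
  LinearMap.mk₂ (𝒪 U) (fun ξ η => (0, Hol.lie (killingSection ξ) (killingSection η)))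
    (fun ξ ξ' η => by simp [Hol.add_lie]) (fun f ξ η => by simp [Hol.smul_lie])
    (fun ξ η η' => by simp [Hol.lie_add]) (fun f ξ η => by simp [Hol.lie_smul])

theorem casimirTrivector_apply (ξ η : Module.Dual (𝒪 U) (GaugeSections U 𝔤)) :
    casimirTrivector U 𝔤 ξ η = (0, Hol.lie (killingSection ξ) (killingSection η)) := rfl

variable [DecidableEq ι]

/-- The 𝔤-valued sections form an ideal, so the 𝔤-part of L_a ξ depends only on that of ξ. The
Killing form is constant on U and ad-invariant, hence carries the dual action to the action on
𝔤-valued functions. -/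
theorem killingSection_lieDual (a : GaugeSections U 𝔤)
    (ξ : Module.Dual (𝒪 U) (GaugeSections U 𝔤)) :
    killingSection ((gaugeAlgebroid U 𝔤).lieDual a ξ)
      = Hol.lie a.2 (killingSection ξ) + lieFun a.1 (killingSection ξ) := by
  refine eq_of_forall_pair_killingForm fun k => ?_
  have hb : (gaugeAlgebroid U 𝔤).bracket a (0, k) = (0, Hol.lie a.2 k + lieFun a.1 k) := by
    rw [gaugeAlgebroid_bracket]
    refine Prod.ext (funext fun j => ?_) ?_ <;> simp
  have hadd : ∀ f g k : Hol U 𝔤, Hol.pair (killingForm ℂ 𝔤) (f + g) k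
      = Hol.pair (killingForm ℂ 𝔤) f k + Hol.pair (killingForm ℂ 𝔤) g k := fun f g k => by
    simp [Hol.pair, add_mul, Finset.sum_add_distrib]
  have hadd' : ∀ f g k : Hol U 𝔤, Hol.pair (killingForm ℂ 𝔤) k (f + g)
      = Hol.pair (killingForm ℂ 𝔤) k f + Hol.pair (killingForm ℂ 𝔤) k g := fun f g k => by
    simp [Hol.pair, mul_add, Finset.sum_add_distrib]
  have hinv : Hol.pair (killingForm ℂ 𝔤) (Hol.lie a.2 (killingSection ξ)) k
      + Hol.pair (killingForm ℂ 𝔤) (killingSection ξ) (Hol.lie a.2 k) = 0 := by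
    refine 𝒪.ext fun x => ?_
    change (Hol.pair (killingForm ℂ 𝔤) (Hol.lie a.2 (killingSection ξ)) k).1 x
      + (Hol.pair (killingForm ℂ 𝔤) (killingSection ξ) (Hol.lie a.2 k)).1 x = 0
    rw [Hol.pair_apply, Hol.pair_apply, Hol.lie_apply, Hol.lie_apply,
      ← _root_.lie_skew (a.2.1 x), map_neg, LinearMap.neg_apply,
      LieModule.traceForm_apply_lie_apply, neg_add_cancel]
  rw [pair_killingSection, lieDual_apply, gaugeAlgebroid_anchor, hb, ← pair_killingSection,
    ← pair_killingSection, vectorField_pair, hadd, hadd']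
  linear_combination -hinv

/-- Cyclicity is the invariance of the Killing form; invariance is Jacobi together with the Leibniz
rule for L_X; the anchor vanishes because the values are 𝔤-valued functions. -/
theorem casimirTrivector_isInvariantTrivector :
    IsInvariantTrivector (gaugeAlgebroid U 𝔤) (casimirTrivector U 𝔤) where
  skew ξ η := by
    rw [casimirTrivector_apply, casimirTrivector_apply, Hol.lie_skew]
    simp
  cyclic ξ η ζ := by
    rw [casimirTrivector_apply, casimirTrivector_apply, ← pair_killingSection,
      ← pair_killingSection]
    refine 𝒪.ext fun x => ?_
    rw [Hol.pair_apply, Hol.pair_apply, Hol.lie_apply, Hol.lie_apply, killingForm_lie_cycle]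
  anchor ξ η := by
    rw [casimirTrivector_apply, gaugeAlgebroid_anchor, map_zero]
  invariant a ξ η := by
    simp only [casimirTrivector_apply, gaugeAlgebroid_bracket, killingSection_lieDual]
    refine Prod.ext (funext fun j => ?_) ?_
    · simp
    · simp only [Prod.snd_add, zero_lieFun, sub_zero, lieFun_lie, Hol.add_lie, Hol.lie_add]
      have h := Hol.lie_jacobi a.2 (killingSection ξ) (killingSection η)
      rw [Hol.lie_skew (Hol.lie (killingSection ξ) _) a.2,
        Hol.lie_skew (Hol.lie (killingSection η) _), Hol.lie_skew (killingSection η) a.2,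
        Hol.lie_neg, neg_neg] at h
      rw [← sub_eq_zero, ← neg_eq_zero, ← h]
      abel

end Trivector

/-! ### Tensoriality of the bracket defect -/

section Spanning

variable {R Γ : Type*} [CommRing R] [Algebra ℂ R] [AddCommGroup Γ] [Module R Γ]

/-- Whether `Λ^#` preserves brackets up to `Φ` can be tested on generators of the dual module. -/
theorem sharp_bracket_of_span {A : AlmostLieAlgebroid R Γ} {Λ : Bivector R Γ}
    {Φ : Module.Dual R Γ →ₗ[R] Module.Dual R Γ →ₗ[R] Γ} (hskew : ∀ ξ η, Φ ξ η = -Φ η ξ)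
    {S : Set (Module.Dual R Γ)} (hS : Submodule.span R S = ⊤)
    (h : ∀ ξ ∈ S, ∀ η ∈ S, sharp Λ ((coboundaryDual A Λ).bracket ξ η)
      = A.bracket (sharp Λ ξ) (sharp Λ η) + Φ ξ η) (ξ η : Module.Dual R Γ) :
    sharp Λ ((coboundaryDual A Λ).bracket ξ η) = A.bracket (sharp Λ ξ) (sharp Λ η) + Φ ξ η := by
  have symm : ∀ ξ η, sharp Λ ((coboundaryDual A Λ).bracket ξ η)
      = A.bracket (sharp Λ ξ) (sharp Λ η) + Φ ξ η →
      sharp Λ ((coboundaryDual A Λ).bracket η ξ)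
      = A.bracket (sharp Λ η) (sharp Λ ξ) + Φ η ξ := fun ξ η h => by
    rw [(coboundaryDual A Λ).bracket_skew, map_neg, h, A.bracket_skew, hskew]
    abel
  have ext : ∀ ξ, (∀ η ∈ S, sharp Λ ((coboundaryDual A Λ).bracket ξ η)
      = A.bracket (sharp Λ ξ) (sharp Λ η) + Φ ξ η) →
      ∀ η, sharp Λ ((coboundaryDual A Λ).bracket ξ η)
      = A.bracket (sharp Λ ξ) (sharp Λ η) + Φ ξ η := fun ξ h η => by
    have hη : η ∈ Submodule.span R S := hS ▸ Submodule.mem_top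
    induction hη using Submodule.span_induction with
    | mem η hη => exact h η hη
    | zero => simp
    | add η η' _ _ h h' =>
      simp only [(coboundaryDual A Λ).bracket_add, map_add, h, h', A.bracket_add]
      abel
    | smul f η _ h =>
      simp only [(coboundaryDual A Λ).bracket_smul, map_add, map_smul, h, A.bracket_smul, smul_add]
      -- Both Leibniz rules produce the same anchor term, because the anchor of A^* is a ∘ Λ^#;
      -- hence the defect is linear over functions.
      change _ + A.anchor (sharp Λ ξ) f • _ = _
      abel
  exact ext ξ (fun η hη => symm _ _ (ext η (fun ξ hξ => h η hη ξ hξ) ξ)) η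

end Spanning

/-! ### The dynamical Yang-Baxter equation as a bracket defect -/

section Gauge

variable {ι : Type*} [Fintype ι] {U : Opens (ι → ℂ)}
variable {𝔤 : Type*} [LieRing 𝔤] [LieAlgebra ℂ 𝔤] [Module.Finite ℂ 𝔤]

/-- Evaluation at a point, as a ring homomorphism. -/
def evalAt (x : U) : 𝒪 U →+* ℂ :=
  (Pi.evalRingHom (fun _ : U => ℂ) x).comp (holSubalgebra U).val.toRingHom

theorem eq_of_forall_evalAt {f g : 𝒪 U} (h : ∀ x, evalAt x f = evalAt x g) : f = g := 𝒪.ext h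

@[simp] theorem evalAt_comp {V : Type*} [AddCommGroup V] [Module ℂ V] (x : U)
    (φ : Module.Dual ℂ V) (f : Hol U V) : evalAt x (Hol.comp φ f) = φ (f.1 x) := rfl

/-- The section `∑ c_i dλ_i + φ` of `A^*`, with constant coefficients. -/
def constDual (c : ι → ℂ) (φ : Module.Dual ℂ 𝔤) : Module.Dual (𝒪 U) (GaugeSections U 𝔤) :=
  (∑ i, algebraMap ℂ (𝒪 U) (c i) • LinearMap.proj i).coprod (Hol.comp φ)

theorem constDual_apply (c : ι → ℂ) (φ : Module.Dual ℂ 𝔤) (a : GaugeSections U 𝔤) :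
    constDual c φ a = ∑ i, algebraMap ℂ (𝒪 U) (c i) * a.1 i + Hol.comp φ a.2 := by
  simp [constDual, LinearMap.sum_apply, Algebra.smul_def]

/-- The dλ_i and a dual basis of 𝔤 already generate. On covectors with constant coefficients, the
only derivatives that survive below are those of r. -/
theorem span_constDual : Submodule.span (𝒪 U) (Set.range fun p : (ι → ℂ) × Module.Dual ℂ 𝔤 =>
    constDual (U := U) p.1 p.2) = ⊤ := by
  classical
  refine eq_top_iff.2 fun ξ _ => ?_
  have h : ξ = ∑ i, ξ (Pi.single i 1, 0) • constDual (Pi.single i 1) 0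
      + ∑ j, ξ (constSection (Module.finBasis ℂ 𝔤 j))
        • constDual 0 ((Module.finBasis ℂ 𝔤).coord j) := by
    refine LinearMap.ext fun a => ?_
    have ha : a = ∑ i, a.1 i • ((Pi.single i 1, 0) : GaugeSections U 𝔤)
        + ∑ j, Hol.comp ((Module.finBasis ℂ 𝔤).coord j) a.2
          • constSection (Module.finBasis ℂ 𝔤 j) := by
      refine Prod.ext (funext fun i => ?_) ?_
      · simp [Prod.fst_sum, constSection, Pi.single_apply]
      · simp [Prod.snd_sum, constSection, Hol.sum_comp_coord]
    conv_lhs => rw [ha]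
    have h0 : Hol.comp (0 : Module.Dual ℂ 𝔤) a.2 = 0 := rfl
    simp only [map_add, map_sum, map_smul, LinearMap.add_apply, LinearMap.sum_apply,
      LinearMap.smul_apply, constDual_apply, smul_eq_mul, h0, add_zero, Pi.zero_apply, map_zero,
      zero_mul, Finset.sum_const_zero, zero_add]
    congr 1
    · refine Finset.sum_congr rfl fun i _ => ?_
      rw [Finset.sum_eq_single i]
      · simp [mul_comm]
      · intro j _ hj; simp [hj]
      · simp
    · exact Finset.sum_congr rfl fun j _ => mul_comm _ _
  rw [h]
  exact add_mem (sum_mem fun i _ => Submodule.smul_mem _ _ (Submodule.subset_span ⟨(_, _), rfl⟩))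
    (sum_mem fun j _ => Submodule.smul_mem _ _ (Submodule.subset_span ⟨(_, _), rfl⟩))

/-- The contraction `⋀² 𝔤 → 𝔤` with a linear form. -/
def sharpMap (φ : Module.Dual ℂ 𝔤) : Bivector ℂ 𝔤 →ₗ[ℂ] 𝔤 :=
  contractLeft φ ∘ₗ (Bivector ℂ 𝔤).subtype

theorem sharpMap_apply (φ : Module.Dual ℂ 𝔤) (t : Bivector ℂ 𝔤) : sharpMap φ t = sharp t φ := rfl

/-- Left and right contractions of a bivector are opposite, so the left one is half their
difference; this matches the form 1/2 ∑ r_{jk} b_j ∧ b_k used in `toBivector`. -/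
theorem sharp_basis_expansion (φ : Module.Dual ℂ 𝔤) (t : Bivector ℂ 𝔤) :
    sharp t φ = ∑ j, ∑ k, ((1 / 2 : ℂ)
      * ((Module.finBasis ℂ 𝔤).tensorProduct (Module.finBasis ℂ 𝔤)).repr (t : 𝔤 ⊗[ℂ] 𝔤) (j, k))
      • (φ (Module.finBasis ℂ 𝔤 j) • Module.finBasis ℂ 𝔤 k
        - φ (Module.finBasis ℂ 𝔤 k) • Module.finBasis ℂ 𝔤 j) := by
  have h : sharp t φ = (1 / 2 : ℂ) • (contractLeft φ (t : 𝔤 ⊗[ℂ] 𝔤)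
      - contractRight φ (t : 𝔤 ⊗[ℂ] 𝔤)) := by
    rw [contractRight_bivector, ← sharp_eq_contractLeft, sub_neg_eq_add, smul_add, ← add_smul]
    norm_num
  rw [h]
  conv_lhs =>
    rw [← ((Module.finBasis ℂ 𝔤).tensorProduct (Module.finBasis ℂ 𝔤)).sum_repr (t : 𝔤 ⊗[ℂ] 𝔤)]
  rw [Fintype.sum_prod_type]
  simp only [map_sum, map_smul, Module.Basis.tensorProduct_apply, contractLeft_tmul,
    contractRight_tmul, ← Finset.sum_sub_distrib, Finset.smul_sum, ← smul_sub, mul_smul]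

variable [DecidableEq ι]

theorem sharp_toBivector (r : Hol U (Bivector ℂ 𝔤)) (c : ι → ℂ) (φ : Module.Dual ℂ 𝔤) :
    sharp (toBivector r) (constDual c φ) = (0, Hol.map (sharpMap φ) r) := by
  simp only [toBivector, sharp_sum, sharp_smul, sharp_wedge, constDual_apply, constSection,
    Pi.zero_apply, mul_zero, Finset.sum_const_zero, zero_add]
  refine Prod.ext ?_ (Hol.ext fun x => ?_)
  · simp [Prod.fst_sum]
  · simp only [Prod.snd_sum, Prod.smul_snd, Prod.snd_sub]
    rw [Hol.map_apply, sharpMap_apply, sharp_basis_expansion]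
    change Hol.eval x _ = _
    simp only [map_sum]
    rfl

/-- The bivector `∑ k_i ∧ ∂/∂λ_i + r`. -/
def gaugeBivector (k : ι → 𝔤) (r : Hol U (Bivector ℂ 𝔤)) :
    Bivector (𝒪 U) (GaugeSections U 𝔤) :=
  ∑ i, wedge (𝒪 U) (constSection (k i)) (coordSection i) + toBivector r

theorem sharp_gaugeBivector (k : ι → 𝔤) (r : Hol U (Bivector ℂ 𝔤)) (c : ι → ℂ)
    (φ : Module.Dual ℂ 𝔤) :
    sharp (gaugeBivector k r) (constDual c φ) = (fun i => algebraMap ℂ (𝒪 U) (φ (k i)),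
      Hol.map (sharpMap φ) r - Hol.const U (∑ i, c i • k i)) := by
  rw [gaugeBivector, sharp_add, sharp_toBivector, sharp_sum]
  simp only [sharp_wedge, constDual_apply, constSection, coordSection]
  refine Prod.ext (funext fun j => ?_) ?_
  · simp [Prod.fst_sum, Pi.single_apply, Algebra.smul_def]
  · simp [Prod.snd_sum, Hol.const_sum, Hol.const_smul, Pi.single_apply, sub_eq_neg_add]

theorem vectorField_algebraMap (X : ι → 𝒪 U) (c : ℂ) :
    vectorField X (algebraMap ℂ (𝒪 U) c) = 0 := Derivation.map_algebraMap _ _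

variable [LieAlgebra.IsKilling ℂ 𝔤]

theorem killingSection_constDual (c : ι → ℂ) (φ : Module.Dual ℂ 𝔤) :
    killingSection (constDual (U := U) c φ) = Hol.const U (killingVec φ) := by
  rw [killingSection_apply, killingVec_eq, Hol.const_sum]
  refine Finset.sum_congr rfl fun j _ => ?_
  rw [Hol.const_smul, constDual_apply]
  simp [constSection]

/-- The contracted form of the modified classical dynamical Yang-Baxter equation for
`∑ k_i ∧ ∂/∂λ_i + r`. -/
def ContractedCDYBE (k : ι → 𝔤) (r : Hol U (Bivector ℂ 𝔤)) : Prop :=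
  ∀ (x : U) (φ ψ χ : Module.Dual ℂ 𝔤),
    ∑ i, (φ (k i) * χ (sharp ((Hol.partialDeriv i r).1 x) ψ)
      - ψ (k i) * χ (sharp ((Hol.partialDeriv i r).1 x) φ)
      + χ (k i) * ψ (sharp ((Hol.partialDeriv i r).1 x) φ))
    + (φ ⁅sharp (r.1 x) ψ, sharp (r.1 x) χ⁆ + ψ ⁅sharp (r.1 x) χ, sharp (r.1 x) φ⁆
      + χ ⁅sharp (r.1 x) φ, sharp (r.1 x) ψ⁆) = ψ ⁅killingVec φ, killingVec χ⁆

theorem lieFun_const_apply (X : ι → ℂ) (r : Hol U (Bivector ℂ 𝔤)) (x : U)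
    (φ χ : Module.Dual ℂ 𝔤) :
    χ (sharp ((lieFun (fun i => algebraMap ℂ (𝒪 U) (X i)) r).1 x) φ)
      = ∑ i, X i * χ (sharp ((Hol.partialDeriv i r).1 x) φ) := by
  have h : (lieFun (fun i => algebraMap ℂ (𝒪 U) (X i)) r).1 x
      = ∑ i, X i • (Hol.partialDeriv i r).1 x := by
    change Hol.eval x _ = _
    rw [lieFun, map_sum]
    rfl
  rw [h, ← sharpMap_apply]
  simp [sharpMap_apply]

/-- By tensoriality it suffices to pair the identity with three constant covectors. The terms
without dλ-parts are the contracted Yang-Baxter equation; those linear in a dλ-part cancel by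
invariance of r under the k_i, and the remaining ones vanish because the k_i commute. -/
theorem sharp_gaugeBivector_bracket {k : ι → 𝔤} {r : Hol U (Bivector ℂ 𝔤)}
    (hk : ∀ i j, ⁅k i, k j⁆ = 0) (hinv : ∀ x i, ⁅k i, ((r.1 x : Bivector ℂ 𝔤) : 𝔤 ⊗[ℂ] 𝔤)⁆ = 0)
    (hr : ContractedCDYBE k r) (ξ η : Module.Dual (𝒪 U) (GaugeSections U 𝔤)) :
    sharp (gaugeBivector k r) ((coboundaryDual (gaugeAlgebroid U 𝔤) (gaugeBivector k r)).bracket ξ η)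
      = (gaugeAlgebroid U 𝔤).bracket (sharp (gaugeBivector k r) ξ) (sharp (gaugeBivector k r) η)
        + casimirTrivector U 𝔤 ξ η := by
  refine sharp_bracket_of_span (casimirTrivector_isInvariantTrivector (U := U) (𝔤 := 𝔤)).skew
    span_constDual ?_ ξ η
  rintro _ ⟨⟨c₁, φ⟩, rfl⟩ _ ⟨⟨c₂, ψ⟩, rfl⟩
  refine eq_of_forall_dual (𝒪 U) fun ζ => ?_
  have hζ : ζ ∈ Submodule.span (𝒪 U) (Set.range fun p : (ι → ℂ) × Module.Dual ℂ 𝔤 =>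
    constDual (U := U) p.1 p.2) := by
    rw [span_constDual]; exact Submodule.mem_top
  induction hζ using Submodule.span_induction with
  | zero => rfl
  | add ζ ζ' _ _ h h' => rw [LinearMap.add_apply, LinearMap.add_apply, h, h']
  | smul f ζ _ h => rw [LinearMap.smul_apply, LinearMap.smul_apply, h]
  | mem ζ hζ =>
  obtain ⟨⟨c₃, χ⟩, rfl⟩ := hζ
  -- Moves Λ^# from the non-constant covector [ξ, η]_Λ to the constant test covector, where
  -- `sharp_gaugeBivector` applies.
  rw [sharp_skew, coboundaryDual_bracket_apply]
  simp only [sharp_gaugeBivector, gaugeAlgebroid_anchor, gaugeAlgebroid_bracket, constDual_apply,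
    casimirTrivector_apply, killingSection_constDual, vectorField_algebraMap, map_add, map_sub,
    map_sum, Derivation.leibniz, smul_zero, sub_zero, mul_zero, Finset.sum_const_zero, zero_add,
    lieFun_sub, lieFun_const, lieFun_map, Hol.comp_const, ← Hol.comp_lieFun, add_zero,
    Pi.zero_apply, Hol.comp_map]
  refine eq_of_forall_evalAt fun x => ?_
  have hu : ∀ (c : ι → ℂ) (φ ψ : Module.Dual ℂ 𝔤), ψ ⁅∑ i, c i • k i, sharp (r.1 x) φ⁆
      = φ ⁅∑ i, c i • k i, sharp (r.1 x) ψ⁆ := fun c φ ψ =>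
    sharp_invariant (by simp [sum_lie, hinv]) φ ψ
  have hu0 : ∀ c c' : ι → ℂ, ⁅∑ i, c i • k i, ∑ i, c' i • k i⁆ = 0 := fun c c' => by
    simp [sum_lie, lie_sum, hk]
  have hsub : ∀ (φ : Module.Dual ℂ 𝔤) (c : ι → ℂ),
      (Hol.map (sharpMap φ) r - Hol.const U (∑ i, c i • k i)).1 x
      = sharp (r.1 x) φ - ∑ i, c i • k i := fun φ c => rfl
  have hconst : ∀ v : 𝔤, (Hol.const U v).1 x = v := fun v => rfl
  simp only [map_neg, map_sub, map_add, evalAt_comp, Hol.lie_apply, LinearMap.comp_apply,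
    sharpMap_apply, hsub, hconst]
  rw [sharp_skew (Subtype.val (lieFun (fun i => algebraMap ℂ (𝒪 U) (χ (k i))) r) x) ψ φ]
  simp only [lieFun_const_apply, sub_lie, lie_sub, hu0, map_sub, map_zero]
  have hr' := hr x φ ψ χ
  simp only [Finset.sum_add_distrib, Finset.sum_sub_distrib] at hr'
  -- The trivector has its third covector outside the bracket, while [Ω¹², Ω²³] has the middle one
  -- there; exchanging them costs a sign.
  have hK : χ ⁅killingVec φ, killingVec ψ⁆ = -ψ ⁅killingVec φ, killingVec χ⁆ := by
    rw [← killingForm_killingVec χ, ← killingForm_killingVec ψ, killingForm_lie_cycle,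
      killingForm_lie_cycle, ← _root_.lie_skew, map_neg]
  have hs : ∀ (χ φ : Module.Dual ℂ 𝔤) (c : ι → ℂ), χ ⁅sharp (r.1 x) φ, ∑ i, c i • k i⁆
      = -χ ⁅∑ i, c i • k i, sharp (r.1 x) φ⁆ := fun χ φ c => by
    rw [← _root_.lie_skew, map_neg]
  have hs' : ψ ⁅sharp (r.1 x) χ, sharp (r.1 x) φ⁆ = -ψ ⁅sharp (r.1 x) φ, sharp (r.1 x) χ⁆ := by
    rw [← _root_.lie_skew, map_neg]
  simp only [hs, hK]
  -- The three uses of `hu` remove the cross terms with the dλ-part of each of the three covectors.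
  linear_combination -hr' + hs' - hu c₁ χ ψ + hu c₃ φ ψ + hu c₂ χ φ

end Gauge

open LieAlgebra LieAlgebra.IsKilling

/-! ### The modified Yang-Baxter equation for the standard r-matrix -/

section Standard

variable {𝔤 : Type*} [LieRing 𝔤] [LieAlgebra ℂ 𝔤] [Module.Finite ℂ 𝔤] [LieAlgebra.IsKilling ℂ 𝔤]
  {H : LieSubalgebra ℂ 𝔤} [H.IsCartanSubalgebra]

/-- A weight that is a positive root. -/
def IsPosWeight (b : (rootSystem H).Base) (α : LieModule.Weight ℂ H 𝔤) : Prop :=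
  ∃ hα : α ∈ H.root, b.IsPos ⟨α, hα⟩

variable {b : (rootSystem H).Base} {α β γ : LieModule.Weight ℂ H 𝔤}

theorem IsPosWeight.isNonZero (h : IsPosWeight b α) : α.IsNonZero := by
  simpa using h.1

theorem IsPosWeight.add (hα : IsPosWeight b α) (hβ : IsPosWeight b β) (hγ : γ.IsNonZero)
    (h : (γ : H → ℂ) = α + β) : IsPosWeight b γ := by
  have hγ' : γ ∈ H.root := by simpa using hγ
  refine ⟨hγ', hα.2.add hβ.2 ?_⟩
  simp only [rootSystem_root_apply]
  exact LinearMap.ext fun x => congrFun h x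

/-- Opposite roots have opposite heights, while positive roots have positive height. -/
theorem IsPosWeight.not_neg (hα : IsPosWeight b α) (hβ : IsPosWeight b β) :
    (α : H → ℂ) + β ≠ 0 := by
  intro h
  have h0 : b.height ⟨α, hα.1⟩ + b.height ⟨β, hβ.1⟩ = 0 := by
    let _ := (rootSystem H).indexNeg
    have hr : (rootSystem H).root ⟨α, hα.1⟩ = -(rootSystem H).root ⟨β, hβ.1⟩ := by
      simp only [rootSystem_root_apply]
      exact LinearMap.ext fun x => eq_neg_of_add_eq_zero_left (congrFun h x)
    have hi : (⟨α, hα.1⟩ : H.root) = -⟨β, hβ.1⟩ := (rootSystem H).root_eq_neg_iff.1 hr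
    rw [hi, b.height_reflectionPerm_self, neg_add_cancel]
  have h1 := hα.2
  have h2 := hβ.2
  rw [RootPairing.Base.isPos_iff] at h1 h2
  omega

theorem isPosWeight_or_neg (hα : α.IsNonZero) : IsPosWeight b α ∨ IsPosWeight b (-α) := by
  let _ := (rootSystem H).indexNeg
  have hα' : α ∈ H.root := by simpa using hα
  have hα'' : -α ∈ H.root := by simpa using hα
  have hi : (⟨-α, hα''⟩ : H.root) = -⟨α, hα'⟩ := (rootSystem H).root_eq_neg_iff.1 <| by
    simp
  rcases RootPairing.Base.IsPos.or_neg b ⟨α, hα'⟩ with h | h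
  · exact Or.inl ⟨hα', h⟩
  · exact Or.inr ⟨hα'', hi ▸ h⟩

/-- The decomposition of 𝔤 into the Cartan subalgebra (the zero weight space) and the positive and
negative root spaces. It lets a bilinear identity be tested piece by piece. -/
theorem root_induction (b : (rootSystem H).Base) {p : 𝔤 → Prop} (zero : p 0)
    (add : ∀ x y, p x → p y → p (x + y)) (cartan : ∀ x ∈ H, p x)
    (pos : ∀ α : LieModule.Weight ℂ H 𝔤, IsPosWeight b α → ∀ x ∈ rootSpace H α, p x)
    (neg : ∀ α : LieModule.Weight ℂ H 𝔤, IsPosWeight b (-α) → ∀ x ∈ rootSpace H α, p x)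
    (x : 𝔤) : p x := by
  have hx : x ∈ ⨆ χ : LieModule.Weight ℂ H 𝔤, LieModule.genWeightSpace 𝔤 χ := by
    rw [LieModule.iSup_genWeightSpace_eq_top' ℂ H 𝔤]
    exact LieSubmodule.mem_top x
  induction hx using LieSubmodule.iSup_induction' with
  | mem α x hx =>
    by_cases hα : α.IsZero
    · refine cartan x ?_
      have h0 : x ∈ rootSpace H (0 : H → ℂ) := by rwa [← hα.eq]
      rwa [rootSpace_zero_eq, LieSubalgebra.mem_toLieSubmodule] at h0
    · rcases isPosWeight_or_neg (b := b) hα with h | h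
      · exact pos α h x hx
      · exact neg α h x hx
  | zero => exact zero
  | add x y _ _ hx hy => exact add x y hx hy

variable {E : LieModule.Weight ℂ H 𝔤 → 𝔤}

/-- The standard `r`-matrix as an endomorphism, by the Killing form. -/
def standardEnd (b : (rootSystem H).Base) (E : LieModule.Weight ℂ H 𝔤 → 𝔤) : Module.End ℂ 𝔤 :=
  sharp (standardR H b E) ∘ₗ killingForm ℂ 𝔤

open Classical in
theorem standardEnd_apply (x : 𝔤) : standardEnd b E x = ∑ α : H.root with b.IsPos α,
    (killingForm ℂ 𝔤 x (E α.1) • E (-α.1) - killingForm ℂ 𝔤 x (E (-α.1)) • E α.1) := by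
  simp only [standardEnd, LinearMap.comp_apply, standardR, sharp_sum, sharp_wedge]

/-- Root spaces are lines, and the normalisation forces `E α` to be nonzero. -/
theorem exists_eq_smul (hE : ∀ α : LieModule.Weight ℂ H 𝔤, α.IsNonZero → E α ∈ rootSpace H α)
    (hE_one : ∀ α : LieModule.Weight ℂ H 𝔤, α.IsNonZero → killingForm ℂ 𝔤 (E α) (E (-α)) = 1)
    (hα : α.IsNonZero) {x : 𝔤} (hx : x ∈ rootSpace H α) : ∃ c : ℂ, x = c • E α := by
  have h0 : (⟨E α, hE α hα⟩ : rootSpace H α) ≠ 0 := fun h => by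
    have h1 : E α = 0 := congrArg Subtype.val h
    have h2 := hE_one α hα
    simp [h1] at h2
  obtain ⟨c, hc⟩ := (finrank_eq_one_iff_of_nonzero' _ h0).1 (finrank_rootSpace_eq_one α hα) ⟨x, hx⟩
  exact ⟨c, congrArg Subtype.val hc.symm⟩

theorem standardEnd_cartan
    (hE : ∀ α : LieModule.Weight ℂ H 𝔤, α.IsNonZero → E α ∈ rootSpace H α) {x : 𝔤} (hx : x ∈ H) :
    standardEnd b E x = 0 := by
  classical
  have hx' : x ∈ rootSpace H (0 : H → ℂ) := toLieSubmodule_le_rootSpace_zero ℂ 𝔤 H hx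
  rw [standardEnd_apply]
  refine Finset.sum_eq_zero fun α _ => ?_
  have hα : α.1.IsNonZero := (Finset.mem_filter.1 α.2).2
  have hα' : (-α.1).IsNonZero := by simpa using hα
  rw [killingForm_apply_eq_zero_of_mem_rootSpace_of_add_ne_zero ℂ 𝔤 H hx' (hE _ hα)
      (by rw [zero_add]; exact hα),
    killingForm_apply_eq_zero_of_mem_rootSpace_of_add_ne_zero ℂ 𝔤 H hx' (hE _ hα')
      (by rw [zero_add]; exact hα'), zero_smul, zero_smul, sub_zero]

/-- Among the root vectors occurring in `r₀`, `E α` pairs nontrivially only with `E (-α)`. That is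
the second leg of the summand for `α`, hence the sign; for a negative root it is a first leg. -/
theorem standardEnd_pos
    (hE : ∀ α : LieModule.Weight ℂ H 𝔤, α.IsNonZero → E α ∈ rootSpace H α)
    (hE_one : ∀ α : LieModule.Weight ℂ H 𝔤, α.IsNonZero → killingForm ℂ 𝔤 (E α) (E (-α)) = 1)
    (hα : IsPosWeight b α) {x : 𝔤} (hx : x ∈ rootSpace H α) : standardEnd b E x = -x := by
  classical
  obtain ⟨c, rfl⟩ := exists_eq_smul hE hE_one hα.isNonZero hx
  rw [map_smul, ← smul_neg]
  congr 1
  rw [standardEnd_apply, Finset.sum_eq_single ⟨α, hα.1⟩]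
  · rw [killingForm_apply_eq_zero_of_mem_rootSpace_of_add_ne_zero ℂ 𝔤 H (hE α hα.isNonZero)
      (hE α hα.isNonZero) (hα.not_neg hα), hE_one α hα.isNonZero]
    simp
  · intro β hβ hne
    have hβ' : IsPosWeight b β.1 := ⟨β.2, (Finset.mem_filter.1 hβ).2⟩
    rw [killingForm_apply_eq_zero_of_mem_rootSpace_of_add_ne_zero ℂ 𝔤 H (hE α hα.isNonZero)
      (hE _ hβ'.isNonZero) (hα.not_neg hβ'),
      killingForm_apply_eq_zero_of_mem_rootSpace_of_add_ne_zero ℂ 𝔤 H (hE α hα.isNonZero)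
      (hE _ (by simpa using hβ'.isNonZero)), zero_smul, zero_smul, sub_zero]
    intro h
    refine hne (Subtype.ext (DFunLike.coe_injective ?_))
    rw [LieModule.Weight.coe_neg, add_neg_eq_zero] at h
    exact h.symm
  · intro h
    exact absurd (Finset.mem_filter.2 ⟨Finset.mem_univ _, hα.2⟩) h

theorem standardEnd_neg
    (hE : ∀ α : LieModule.Weight ℂ H 𝔤, α.IsNonZero → E α ∈ rootSpace H α)
    (hE_one : ∀ α : LieModule.Weight ℂ H 𝔤, α.IsNonZero → killingForm ℂ 𝔤 (E α) (E (-α)) = 1)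
    (hα : IsPosWeight b (-α)) {x : 𝔤} (hx : x ∈ rootSpace H α) : standardEnd b E x = x := by
  classical
  have hα0 : α.IsNonZero := by simpa using hα.isNonZero
  obtain ⟨c, rfl⟩ := exists_eq_smul hE hE_one hα0 hx
  rw [map_smul]
  congr 1
  have key : ∀ β : LieModule.Weight ℂ H 𝔤, IsPosWeight b β →
      killingForm ℂ 𝔤 (E α) (E (-β)) = 0 := fun β hβ => by
    refine killingForm_apply_eq_zero_of_mem_rootSpace_of_add_ne_zero ℂ 𝔤 H (hE α hα0)
      (hE _ (by simpa using hβ.isNonZero)) fun h => hα.not_neg hβ ?_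
    rw [LieModule.Weight.coe_neg] at h ⊢
    rw [← neg_eq_zero, ← h]
    abel
  rw [standardEnd_apply, Finset.sum_eq_single ⟨-α, hα.1⟩]
  · rw [key _ hα, hE_one α hα0, neg_neg]
    simp
  · intro β hβ hne
    have hβ' : IsPosWeight b β.1 := ⟨β.2, (Finset.mem_filter.1 hβ).2⟩
    rw [key _ hβ', killingForm_apply_eq_zero_of_mem_rootSpace_of_add_ne_zero ℂ 𝔤 H (hE α hα0)
      (hE _ hβ'.isNonZero), zero_smul, zero_smul, sub_zero]
    intro h
    refine hne (Subtype.ext (DFunLike.coe_injective ?_))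
    rw [LieModule.Weight.coe_neg]
    exact eq_neg_of_add_eq_zero_right h
  · intro h
    exact absurd (Finset.mem_filter.2 ⟨Finset.mem_univ _, hα.2⟩) h

/-- A nonzero bracket lies in the root space of α + β, which is then a positive root. -/
theorem standardEnd_lie_pos
    (hE : ∀ α : LieModule.Weight ℂ H 𝔤, α.IsNonZero → E α ∈ rootSpace H α)
    (hE_one : ∀ α : LieModule.Weight ℂ H 𝔤, α.IsNonZero → killingForm ℂ 𝔤 (E α) (E (-α)) = 1)
    (hα : IsPosWeight b α) (hβ : IsPosWeight b β) {x y : 𝔤} (hx : x ∈ rootSpace H α)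
    (hy : y ∈ rootSpace H β) : standardEnd b E ⁅x, y⁆ = -⁅x, y⁆ := by
  have hxy := lie_mem_genWeightSpace_of_mem_genWeightSpace hx hy
  by_cases h0 : ⁅x, y⁆ = 0
  · simp [h0]
  have hne : LieModule.genWeightSpace 𝔤 ((α : H → ℂ) + (β : H → ℂ)) ≠ ⊥ := fun h => by
    rw [h, LieSubmodule.mem_bot] at hxy
    exact h0 hxy
  have hγ : IsPosWeight b (⟨_, hne⟩ : LieModule.Weight ℂ H 𝔤) :=
    hα.add hβ (fun h => hα.not_neg hβ h) rfl
  exact standardEnd_pos hE hE_one hγ hxy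

theorem standardEnd_lie_neg
    (hE : ∀ α : LieModule.Weight ℂ H 𝔤, α.IsNonZero → E α ∈ rootSpace H α)
    (hE_one : ∀ α : LieModule.Weight ℂ H 𝔤, α.IsNonZero → killingForm ℂ 𝔤 (E α) (E (-α)) = 1)
    (hα : IsPosWeight b (-α)) (hβ : IsPosWeight b (-β)) {x y : 𝔤} (hx : x ∈ rootSpace H α)
    (hy : y ∈ rootSpace H β) : standardEnd b E ⁅x, y⁆ = ⁅x, y⁆ := by
  have hxy := lie_mem_genWeightSpace_of_mem_genWeightSpace hx hy
  by_cases h0 : ⁅x, y⁆ = 0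
  · simp [h0]
  have hne : LieModule.genWeightSpace 𝔤 ((α : H → ℂ) + (β : H → ℂ)) ≠ ⊥ := fun h => by
    rw [h, LieSubmodule.mem_bot] at hxy
    exact h0 hxy
  have hs : (α : H → ℂ) + β ≠ 0 := fun h => hα.not_neg hβ <| by
    rw [LieModule.Weight.coe_neg, LieModule.Weight.coe_neg, ← neg_add, h, neg_zero]
  have hγ : IsPosWeight b (-(⟨_, hne⟩ : LieModule.Weight ℂ H 𝔤)) := by
    refine hα.add hβ (LieModule.Weight.isNonZero_neg.2 hs) ?_
    simp only [LieModule.Weight.coe_neg, LieModule.Weight.coe_weight_mk, neg_add]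
  exact standardEnd_neg hE hE_one hγ hxy

/-- The modified classical Yang-Baxter equation for the standard `r`-matrix. -/
theorem standardEnd_modified_yangBaxter
    (hE : ∀ α : LieModule.Weight ℂ H 𝔤, α.IsNonZero → E α ∈ rootSpace H α)
    (hE_one : ∀ α : LieModule.Weight ℂ H 𝔤, α.IsNonZero → killingForm ℂ 𝔤 (E α) (E (-α)) = 1)
    (x y : 𝔤) : ⁅standardEnd b E x, standardEnd b E y⁆ + ⁅x, y⁆
      = standardEnd b E (⁅standardEnd b E x, y⁆ + ⁅x, standardEnd b E y⁆) := by
  -- The equation is skew in its arguments, so one order of each mixed pair is enough.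
  have swap : ∀ x y, ⁅standardEnd b E x, standardEnd b E y⁆ + ⁅x, y⁆
      = standardEnd b E (⁅standardEnd b E x, y⁆ + ⁅x, standardEnd b E y⁆) →
      ⁅standardEnd b E y, standardEnd b E x⁆ + ⁅y, x⁆
      = standardEnd b E (⁅standardEnd b E y, x⁆ + ⁅y, standardEnd b E x⁆) := fun x y h => by
    rw [← lie_skew, ← lie_skew y x, ← neg_add, h, ← lie_skew (standardEnd b E y) x,
      ← lie_skew y (standardEnd b E x), ← neg_add, map_neg, add_comm]
  have hlie : ∀ (α : LieModule.Weight ℂ H 𝔤) (h : 𝔤), h ∈ H → ∀ x ∈ rootSpace H α,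
      ⁅h, x⁆ ∈ rootSpace H α := fun α h hh x hx =>
    (rootSpace H α).lie_mem (x := (⟨h, hh⟩ : H)) hx
  have cartan_pos : ∀ h ∈ H, ∀ α : LieModule.Weight ℂ H 𝔤, IsPosWeight b α →
      ∀ x ∈ rootSpace H α, ⁅standardEnd b E h, standardEnd b E x⁆ + ⁅h, x⁆
      = standardEnd b E (⁅standardEnd b E h, x⁆ + ⁅h, standardEnd b E x⁆) := fun h hh α hα x hx => by
    rw [standardEnd_cartan hE hh, standardEnd_pos hE hE_one hα hx, zero_lie, zero_lie, lie_neg,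
      zero_add, zero_add, map_neg, standardEnd_pos hE hE_one hα (hlie α h hh x hx), neg_neg]
  have cartan_neg : ∀ h ∈ H, ∀ α : LieModule.Weight ℂ H 𝔤, IsPosWeight b (-α) →
      ∀ x ∈ rootSpace H α, ⁅standardEnd b E h, standardEnd b E x⁆ + ⁅h, x⁆
      = standardEnd b E (⁅standardEnd b E h, x⁆ + ⁅h, standardEnd b E x⁆) := fun h hh α hα x hx => by
    rw [standardEnd_cartan hE hh, standardEnd_neg hE hE_one hα hx, zero_lie,
      zero_add, standardEnd_neg hE hE_one hα (hlie α h hh x hx)]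
  -- With eigenvalues -1 and 1, both sides vanish without any knowledge of where [x, y] lies.
  have pos_neg : ∀ α : LieModule.Weight ℂ H 𝔤, IsPosWeight b α → ∀ x ∈ rootSpace H α,
      ∀ β : LieModule.Weight ℂ H 𝔤, IsPosWeight b (-β) → ∀ y ∈ rootSpace H β,
      ⁅standardEnd b E x, standardEnd b E y⁆ + ⁅x, y⁆
      = standardEnd b E (⁅standardEnd b E x, y⁆ + ⁅x, standardEnd b E y⁆) :=
    fun α hα x hx β hβ y hy => by
    rw [standardEnd_pos hE hE_one hα hx, standardEnd_neg hE hE_one hβ hy, neg_lie, neg_add_cancel,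
      map_zero]
  induction x using root_induction b with
  | zero => simp
  | add x x' h h' =>
    simp only [map_add, add_lie] at h h' ⊢
    rw [add_add_add_comm, h, h']
    abel
  | cartan x hx =>
    induction y using root_induction b with
    | zero => simp
    | add y y' h h' =>
      simp only [map_add, lie_add] at h h' ⊢
      rw [add_add_add_comm, h, h']
      abel
    | cartan y hy =>
      have h0 : ⁅x, y⁆ = 0 := congrArg Subtype.val (trivial_lie_zero H H ⟨x, hx⟩ ⟨y, hy⟩)
      simp [standardEnd_cartan hE hx, standardEnd_cartan hE hy, h0]
    | pos α hα y hy => exact cartan_pos x hx α hα y hy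
    | neg α hα y hy => exact cartan_neg x hx α hα y hy
  | pos α hα x hx =>
    induction y using root_induction b with
    | zero => simp
    | add y y' h h' =>
      simp only [map_add, lie_add] at h h' ⊢
      rw [add_add_add_comm, h, h']
      abel
    | cartan y hy => exact swap _ _ (cartan_pos y hy α hα x hx)
    | pos β hβ y hy =>
      rw [standardEnd_pos hE hE_one hα hx, standardEnd_pos hE hE_one hβ hy]
      simp only [neg_lie, lie_neg, neg_neg, map_add, map_neg,
        standardEnd_lie_pos hE hE_one hα hβ hx hy]
    | neg β hβ y hy => exact pos_neg α hα x hx β hβ y hy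
  | neg α hα x hx =>
    induction y using root_induction b with
    | zero => simp
    | add y y' h h' =>
      simp only [map_add, lie_add] at h h' ⊢
      rw [add_add_add_comm, h, h']
      abel
    | cartan y hy => exact swap _ _ (cartan_neg y hy α hα x hx)
    | pos β hβ y hy => exact swap _ _ (pos_neg β hβ y hy α hα x hx)
    | neg β hβ y hy =>
      rw [standardEnd_neg hE hE_one hα hx, standardEnd_neg hE hE_one hβ hy]
      simp only [map_add, standardEnd_lie_neg hE hE_one hα hβ hx hy]

/-- With the covectors written as Killing duals of x, y, z, this is the modified Yang-Baxter
equation for x, y paired with z: skewness of `standardEnd` moves it onto z, and invariance of the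
form rotates the brackets. -/
theorem standardR_contracted_yangBaxter
    (hE : ∀ α : LieModule.Weight ℂ H 𝔤, α.IsNonZero → E α ∈ rootSpace H α)
    (hE_one : ∀ α : LieModule.Weight ℂ H 𝔤, α.IsNonZero → killingForm ℂ 𝔤 (E α) (E (-α)) = 1)
    (φ ψ χ : Module.Dual ℂ 𝔤) :
    φ ⁅sharp (standardR H b E) ψ, sharp (standardR H b E) χ⁆
      + ψ ⁅sharp (standardR H b E) χ, sharp (standardR H b E) φ⁆
      + χ ⁅sharp (standardR H b E) φ, sharp (standardR H b E) ψ⁆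
      = ψ ⁅killingVec φ, killingVec χ⁆ := by
  have hsharp : ∀ φ : Module.Dual ℂ 𝔤,
      sharp (standardR H b E) φ = standardEnd b E (killingVec φ) := fun φ => by
    rw [standardEnd, LinearMap.comp_apply]
    congr 1
    exact LinearMap.ext fun y => (killingForm_killingVec φ y).symm
  have hskew : ∀ x y, killingForm ℂ 𝔤 y (standardEnd b E x)
      = -killingForm ℂ 𝔤 (standardEnd b E y) x := fun x y => by
    rw [LieModule.traceForm_comm ℂ 𝔤 𝔤 _ x]
    exact sharp_skew _ _ _
  rw [hsharp, hsharp, hsharp]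
  simp only [← killingForm_killingVec φ, ← killingForm_killingVec ψ, ← killingForm_killingVec χ]
  generalize killingVec φ = x, killingVec ψ = y, killingVec χ = z
  have h := congrArg (killingForm ℂ 𝔤 z) (standardEnd_modified_yangBaxter hE hE_one (b := b) x y)
  rw [hskew, map_add, map_add] at h
  have h1 := killingForm_lie_cycle x (standardEnd b E y) (standardEnd b E z)
  have h2 := killingForm_lie_cycle (standardEnd b E z) (standardEnd b E x) y
  have h3 := killingForm_lie_cycle y x z
  rw [← lie_skew y x, map_neg] at h3
  rw [← h1, h2, ← h3]
  linear_combination h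

end Standard

end DynR

end

/-! ### Comparison of the two doubles -/

open DynR in
theorem theorem3p4
    {𝔤 : Type*} [LieRing 𝔤] [LieAlgebra ℂ 𝔤] [Module.Finite ℂ 𝔤] [LieAlgebra.IsSimple ℂ 𝔤]
    (H : LieSubalgebra ℂ 𝔤) [H.IsCartanSubalgebra]
    (b : (LieAlgebra.IsKilling.rootSystem H).Base)
    (E : LieModule.Weight ℂ H 𝔤 → 𝔤)
    (hE : ∀ α : LieModule.Weight ℂ H 𝔤, α.IsNonZero → E α ∈ LieAlgebra.rootSpace H α)
    (hE_one : ∀ α : LieModule.Weight ℂ H 𝔤, α.IsNonZero →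
      killingForm ℂ 𝔤 (E α) (E (-α)) = 1)
    {ι : Type*} [Fintype ι] [DecidableEq ι] (h : Module.Basis ι ℂ H)
    (U : TopologicalSpace.Opens (ι → ℂ))
    (r : Hol U (Bivector ℂ 𝔤)) (hr : IsDynamicalRMatrix H h r) :
    IsCoboundaryLieBialgebroid (gaugeAlgebroid U 𝔤) (untwistedR H U b E) ∧
    IsCoboundaryLieBialgebroid (gaugeAlgebroid U 𝔤) (twistedR H h r) ∧
    (coboundaryDouble (gaugeAlgebroid U 𝔤) (untwistedR H U b E)).IsCourantAlgebroid ∧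
    (coboundaryDouble (gaugeAlgebroid U 𝔤) (twistedR H h r)).IsCourantAlgebroid ∧
    Nonempty (CourantIso
      (coboundaryDouble (gaugeAlgebroid U 𝔤) (twistedR H h r))
      (coboundaryDouble (gaugeAlgebroid U 𝔤) (untwistedR H U b E))) := by
  have hA : (gaugeAlgebroid U 𝔤).IsLieAlgebroid := gaugeAlgebroid_isLieAlgebroid
  have hΦ : IsInvariantTrivector (gaugeAlgebroid U 𝔤) (casimirTrivector U 𝔤) :=
    casimirTrivector_isInvariantTrivector
  -- Taking k = 0 brings `r₀` under the same lemma as `Λ`; the derivative terms of the dynamical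
  -- equation then disappear.
  have untwisted : untwistedR H U b E = gaugeBivector 0 (Hol.const U (standardR H b E)) := by
    have h0 : ∀ i, wedge (𝒪 U) (constSection ((0 : ι → 𝔤) i)) (coordSection i) = 0 := fun i =>
      Subtype.ext <| by
        change (0 : GaugeSections U 𝔤) ⊗ₜ[𝒪 U] coordSection i
          - coordSection i ⊗ₜ[𝒪 U] (0 : GaugeSections U 𝔤) = 0
        simp
    rw [gaugeBivector, Finset.sum_congr rfl fun i _ => h0 i, Finset.sum_const_zero, zero_add]
    rfl
  have h₀ := sharp_gaugeBivector_bracket (U := U) (k := (0 : ι → 𝔤))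
    (r := Hol.const U (standardR H b E)) (by simp) (by simp) (fun x φ ψ χ => by
      simp only [Pi.zero_apply, map_zero, zero_mul, sub_zero, add_zero, Finset.sum_const_zero,
        zero_add]
      exact standardR_contracted_yangBaxter hE hE_one φ ψ χ)
  -- The h_i commute because the Cartan subalgebra is abelian; contracting the dynamical equation
  -- with three covectors gives the required form.
  have h₁ := sharp_gaugeBivector_bracket (k := fun i => (h i : 𝔤)) (r := r)
    (fun i j => congrArg Subtype.val (LieModule.IsTrivial.trivial (L := H) (M := H) (h i) (h j)))
    (fun x i => hr.zero_weight x _ (h i).2) (fun x φ ψ χ => by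
      have hx := congrArg (contract₃ φ ψ χ) (hr.cdybe x)
      rw [map_add, contract₃_halfSchouten, map_smul, contract₃_casimir] at hx
      simp only [altD, map_sum, map_add, map_sub, contract₃_tmul_left, contract₃_mk,
        contract₃_mk_flip, ← sharp_eq_contractLeft] at hx
      rw [hx]
      -- Coupling constant 2 makes the coefficient ε²/4 equal to 1, so the trivector is exactly the
      -- one obtained from `r₀`.
      norm_num)
  rw [untwisted]
  exact ⟨isCoboundaryLieBialgebroid hA hΦ h₀, isCoboundaryLieBialgebroid hA hΦ h₁,
    coboundaryDouble_isCourantAlgebroid hA hΦ h₀, coboundaryDouble_isCourantAlgebroid hA hΦ h₁,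
    ⟨(coboundaryDoubleIso h₁).trans (coboundaryDoubleIso h₀).symm⟩⟩
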